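/- **Spooky pebbling.** Let $G=(V,E)$ be a finite directed acyclic graph (DAG). A *root* (output) is a vertex of out-degree $0$; let $R$ be the set of roots. A *spooky pebbling strategy* is a sequence $(P_0,S_0),\dots,(P_T,S_T)$ of pairs of subsets of $V$ (pebbles and ghosts) with $P_0=S_0=\emptyset$, $P_T=R$, $S_T=\emptyset$, such that for each $t\in\{1,\dots,T\}$ there is $v\in V$ with one of - *pebble:* $P_t=P_{t-1}\cup\{v\}$, $S_t=S_{t-1}$, and all direct predecessors of $v$ are in $P_{t-1}$; - *unpebble:* $P_t=P_{t-1}\setminus\{v\}$, $S_t=S_{t-1}$, and all direct predecessors of $v$ are in $P_{t-1}$; - *ghost:* $P_t=P_{t-1}\setminus\{v\}$, $S_t=S_{t-1}\cup\{v\}$; - *unghost:* $P_t=P_{t-1}\cup\{v\}$, $S_t=S_{t-1}\setminus\{v\}$, and all direct predecessors of $v$ are in $P_{t-1}$. $G$ *can be spooky pebbled with $P$ pebbles* if there is such a strategy with $|P_t|\le P$ for all $t$. **The graph of a formula.** Let $\Phi=Q_1x_1\cdots Q_nx_n\,(C_1\wedge\dots\wedge C_m)$ with $Q_i\in\{\forall,\exists\}$,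 each $C_j$ a disjunction of at most three different literals. A *$k$-pyramid* has vertices $(a,b)$, $a,b\ge 0$, $a+b<k$, edges $(a+1,b)\to(a,b)$ and $(a,b+1)\to(a,b)$, and apex $(0,0)$. Put $s_i=3(n-i+1)+3$. The Gilbert–Lengauer–Tarjan type graph $G(\Phi)$ has the following vertices. - Clauses: $p_0$ is a source; $p_j$ has as predecessors $p_{j-1}$, the literal vertices of the literals in $C_j$, and $3-|C_j|$ private sources ($1\le j\le m$). Put $q_{n+1}=p_m$. - For each $i$, three disjoint pyramids of sizes $s_i,s_i-1,s_i-2$ with apexes $a_i,d_i,c_i$, the literal vertices $x_i,\bar x_i$, and vertices $g_i,q_i$. - If $Q_i=\exists$, there is one more vertex $\bar x_i'$, and the predecessor sets are: $\bar x_i'\colon\{a_i,c_i\}$; $x_i\colon\{a_i\}$; $\bar x_i\colon\{\bar x_i'\}$; $g_i\colon\{q_{i+1},d_i,x_i,\bar x_i\}$; $q_i\colon\{g_i,\bar x_i'\}$. - If $Q_i=\forall$, the predecessor sets are: $x_i\colon\{c_i\}$; $\bar x_i\colon\{a_i\}$; $g_i\colon\{q_{i+1},d_i,a_i,x_i\}$;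 $q_i\colon\{q_{i+1},g_i,c_i,\bar x_i\}$. Its output is $q_1$. For $k\ge1$ the *diamond* $G^\diamond_k$ has vertices $\{1,\dots,k\}^2$ and edges $(a,b)\to(a+1,b)$, $(a,b)\to(a,b+1)$. Let $G'(\Phi)$ be the graph obtained from $G(\Phi)$ and $G^\diamond_{3n+4}$ by identifying $q_1$ with the input $(1,1)$ of the diamond. For a quantified Boolean formula $F=Q_1x_1\cdots Q_nx_n\,\varphi$ with an arbitrary Boolean formula $\varphi$ (built from constants, variables, $\neg,\wedge,\vee$), let $\Phi_F$ be its Tseitin form: each occurrence of a constant, conjunction or disjunction in $\varphi$ gets a new variable, existentially quantified innermost, with clauses of at most three literals saying that it is equivalent to that subformula, and one more clause asserts $\varphi$. **Theorem.** There is a constant $C$ such that: 1. For every $\Phi$ as above, with $n$ variables and $m$ clauses, $G'(\Phi)$ is a finite DAG with exactly one output and at most $C(n+m+1)^3$ vertices, and $\Phi$ is true if and only if $G'(\Phi)$ can be spooky pebbled with $P=3n+5$ pebbles. 2. For every quantified Boolean formula $F$, $G'(\Phi_F)$ is a finite DAG with exactly one output and at most $C|F|^3$ vertices, where $|F|$ is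 the number of quantifiers of $F$ plus the number of nodes of the syntax tree of its matrix, and $F$ is true if and only if $G'(\Phi_F)$ can be spooky pebbled with $P=3N+5$ pebbles, where $N$ is the number of variables of $\Phi_F$. In particular, for every quantified Boolean formula $F$ there are a DAG $G'$ with one output and a number $P$, given by an explicit construction of polynomial size, such that $F$ is true if and only if $G'$ can be spooky pebbled with $P$ pebbles. -/

import Mathlib

/-! ### The spooky pebble game -/

section Pebbling

variable {V : Type*}

/-- Edges are directed from a vertex to the vertices that depend on it. -/
def Digraph.IsAcyclic (G : Digraph V) : Prop :=
  ∀ v, ¬ Relation.TransGen G.Adj v v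

/-- A root (output) is a vertex of out-degree zero. -/
def Digraph.IsRoot (G : Digraph V) (v : V) : Prop :=
  ∀ w, ¬ G.Adj v w

variable [DecidableEq V]

/-- One move of the spooky pebble game, from pebbles `P` and ghosts `S` to pebbles `P'` and
ghosts `S'`: pebble, unpebble, ghost or unghost a vertex `v`. -/
def SpookyMove (G : Digraph V) (P S P' S' : Finset V) : Prop :=
  ∃ v : V,
    (P' = P ∪ {v} ∧ S' = S ∧ ∀ u, G.Adj u v → u ∈ P) ∨
    (P' = P \ {v} ∧ S' = S ∧ ∀ u, G.Adj u v → u ∈ P) ∨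
    (P' = P \ {v} ∧ S' = S ∪ {v}) ∨
    (P' = P ∪ {v} ∧ S' = S \ {v} ∧ ∀ u, G.Adj u v → u ∈ P)

/-- `(P 0, S 0), …, (P T, S T)` is a spooky pebbling strategy on `G`. -/
structure IsSpookyStrategy (G : Digraph V) (T : ℕ) (P S : ℕ → Finset V) : Prop where
  pebbles_zero : P 0 = ∅
  ghosts_zero : S 0 = ∅
  pebbles_end : ∀ v, v ∈ P T ↔ G.IsRoot v
  ghosts_end : S T = ∅
  move : ∀ t < T, SpookyMove G (P t) (S t) (P (t + 1)) (S (t + 1))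

/-- `G` can be spooky pebbled with `k` pebbles: there is a spooky pebbling strategy of pebbling
cost at most `k` (the number of ghosts is not restricted). -/
def SpookyPebblable (G : Digraph V) (k : ℕ) : Prop :=
  ∃ (T : ℕ) (P S : ℕ → Finset V), IsSpookyStrategy G T P S ∧ ∀ t ≤ T, (P t).card ≤ k

end Pebbling

/-! ### Quantified Boolean formulas -/

inductive Quantifier
  | all
  | ex
  deriving DecidableEq

/-- Truth of `Q₀ x₀ Q₁ x₁ … Qₙ₋₁ xₙ₋₁ F` (`x₀` is quantified outermost). -/
def QuantTrue : (n : ℕ) → (Fin n → Quantifier) → ((Fin n → Bool) → Prop) → Prop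
  | 0, _, F => F Fin.elim0
  | n + 1, Q, F =>
    match Q 0 with
    | .all => ∀ b : Bool, QuantTrue n (fun i => Q i.succ) (fun σ => F (Fin.cons b σ))
    | .ex => ∃ b : Bool, QuantTrue n (fun i => Q i.succ) (fun σ => F (Fin.cons b σ))

/-- Boolean formulas in the variables `x₀, …, xₙ₋₁`. -/
inductive BoolFormula (n : ℕ)
  | const (b : Bool)
  | var (i : Fin n)
  | neg (φ : BoolFormula n)
  | and (φ ψ : BoolFormula n)
  | or (φ ψ : BoolFormula n)

namespace BoolFormula

def eval {n : ℕ} (σ : Fin n → Bool) : BoolFormula n → Bool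
  | const b => b
  | var i => σ i
  | neg φ => !(φ.eval σ)
  | and φ ψ => φ.eval σ && ψ.eval σ
  | or φ ψ => φ.eval σ || ψ.eval σ

def size {n : ℕ} : BoolFormula n → ℕ
  | const _ => 1
  | var _ => 1
  | neg φ => φ.size + 1
  | and φ ψ => φ.size + ψ.size + 1
  | or φ ψ => φ.size + ψ.size + 1

end BoolFormula

/-- A quantified Boolean formula `Q₀ x₀ … Qₙ₋₁ xₙ₋₁ F` with an arbitrary matrix `F`. -/
structure QBF where
  numVars : ℕ
  quant : Fin numVars → Quantifier
  matrix : BoolFormula numVars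

namespace QBF

def IsTrue (F : QBF) : Prop :=
  QuantTrue F.numVars F.quant (fun σ => F.matrix.eval σ = true)

def size (F : QBF) : ℕ := F.numVars + F.matrix.size

end QBF

/-- The literal `(i, true)` is `xᵢ`, the literal `(i, false)` is its negation. -/
abbrev Literal (n : ℕ) := Fin n × Bool

/-- The negation of a literal. -/
def Literal.not {n : ℕ} (l : Literal n) : Literal n := (l.1, !l.2)

/-- A clause: a disjunction of at most three different literals. -/
abbrev Clause (n : ℕ) := {c : Finset (Literal n) // c.card ≤ 3}

/-- The clause `a ∨ b ∨ c` (shorter if literals coincide). -/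
def Clause.of {n : ℕ} (a b c : Literal n) : Clause n := ⟨{a, b, c}, Finset.card_le_three⟩

/-- A quantified Boolean formula whose matrix is a conjunction of clauses of at most three
literals. -/
structure QCNF where
  numVars : ℕ
  quant : Fin numVars → Quantifier
  clauses : List (Clause numVars)

namespace QCNF

def IsTrue (Φ : QCNF) : Prop :=
  QuantTrue Φ.numVars Φ.quant (fun σ => ∀ c ∈ Φ.clauses, ∃ l ∈ c.1, σ l.1 = l.2)

def numClauses (Φ : QCNF) : ℕ := Φ.clauses.length

def size (Φ : QCNF) : ℕ := Φ.numVars + Φ.numClauses + 1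

end QCNF

/-! ### Bringing the matrix into clausal form (Tseitin's transformation)

Every constant, conjunction and disjunction in the matrix gets a new variable, existentially
quantified innermost, with clauses saying that it is equivalent to the subformula. -/

namespace BoolFormula

/-- The number of new variables. -/
def auxCount {n : ℕ} : BoolFormula n → ℕ
  | const _ => 1
  | var _ => 0
  | neg φ => φ.auxCount
  | and φ ψ => φ.auxCount + ψ.auxCount + 1
  | or φ ψ => φ.auxCount + ψ.auxCount + 1

/-- A literal that stands for the formula, and the clauses that define the new variables. The map
`x` names the variables of the formula, the map `y` names the new variables. -/
def tseitin {n N : ℕ} (x : Fin n → Fin N) :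
    (φ : BoolFormula n) → (Fin φ.auxCount → Fin N) → Literal N × List (Clause N)
  | const b, y =>
    let z := y (Fin.last 0)
    ((z, true), [Clause.of (z, b) (z, b) (z, b)])
  | var i, _ => ((x i, true), [])
  | neg φ, y =>
    let A := φ.tseitin x y
    (A.1.not, A.2)
  | and φ ψ, y =>
    let A := φ.tseitin x (fun i => y (i.castAdd ψ.auxCount).castSucc)
    let B := ψ.tseitin x (fun i => y (i.natAdd φ.auxCount).castSucc)
    let z : Literal N := (y (Fin.last _), true)
    (z, Clause.of z.not A.1 A.1 :: Clause.of z.not B.1 B.1 :: Clause.of z A.1.not B.1.not ::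
      (A.2 ++ B.2))
  | or φ ψ, y =>
    let A := φ.tseitin x (fun i => y (i.castAdd ψ.auxCount).castSucc)
    let B := ψ.tseitin x (fun i => y (i.natAdd φ.auxCount).castSucc)
    let z : Literal N := (y (Fin.last _), true)
    (z, Clause.of z A.1.not A.1.not :: Clause.of z B.1.not B.1.not :: Clause.of z.not A.1 B.1 ::
      (A.2 ++ B.2))

end BoolFormula

/-- The clausal form of a quantified Boolean formula. -/
def QBF.toQCNF (F : QBF) : QCNF where
  numVars := F.numVars + F.matrix.auxCount
  quant := Fin.append F.quant (fun _ => Quantifier.ex)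
  clauses :=
    let A := F.matrix.tseitin (Fin.castAdd F.matrix.auxCount) (Fin.natAdd F.numVars)
    Clause.of A.1 A.1 A.1 :: A.2

/-! ### The graph of Gilbert, Lengauer and Tarjan -/

/-- The vertices of the pyramid of size `k`: row `0` is the apex, and row `r` consists of the
`r + 1` positions `(a, b)` with `a + b = r`; the last row has `k` vertices, the sources. -/
abbrev PyramidVertex (k : ℕ) := {v : Fin k × Fin k // v.1.val + v.2.val < k}

/-- The edges of the pyramid: `(a + 1, b) → (a, b)` and `(a, b + 1) → (a, b)`. -/
def PyramidVertex.Adj {k : ℕ} (u v : PyramidVertex k) : Prop :=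
  (u.1.1.val = v.1.1.val + 1 ∧ u.1.2 = v.1.2) ∨ (u.1.1 = v.1.1 ∧ u.1.2.val = v.1.2.val + 1)

namespace QCNF

/-- The sizes `sᵢ`, `sᵢ - 1`, `sᵢ - 2` of the three pyramids of the block of `xᵢ`, where
`sᵢ = 3 (n - i) + 3` and `x₀` is the outermost variable. -/
def pyramidSize (Φ : QCNF) (i : Fin Φ.numVars) (r : Fin 3) : ℕ :=
  3 * (Φ.numVars - i.val) + 3 - r.val

theorem pyramidSize_pos (Φ : QCNF) (i : Fin Φ.numVars) (r : Fin 3) : 0 < Φ.pyramidSize i r := by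
  unfold pyramidSize
  omega

/-- The vertices of the graph.
* `pyr i r v`: the three pyramids (`r = 0, 1, 2`) of the block of `xᵢ`;
* `lit i b`: the vertex of the literal `xᵢ` (`b = true`) or of its negation (`b = false`);
* `bar i h`: only for existential `xᵢ`, the vertex below the negative literal;
* `wit i`: passed when the rest of the graph has been pebbled (for the first time) under `xᵢ`;
* `out i`: the output of the block of `xᵢ`;
* `chk j`: the first `j` clauses have been checked;
* `pad j k`: sources that fill up the `j`-th clause to three inputs. -/
inductive Vertex (Φ : QCNF)
  | pyr (i : Fin Φ.numVars) (r : Fin 3) (v : PyramidVertex (Φ.pyramidSize i r))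
  | lit (i : Fin Φ.numVars) (b : Bool)
  | bar (i : Fin Φ.numVars) (h : Φ.quant i = Quantifier.ex)
  | wit (i : Fin Φ.numVars)
  | out (i : Fin Φ.numVars)
  | chk (j : Fin (Φ.numClauses + 1))
  | pad (j : Fin Φ.numClauses) (k : Fin (3 - (Φ.clauses.get j).1.card))
  deriving DecidableEq

variable (Φ : QCNF)

/-- The apex of the `r`-th pyramid of the block of `xᵢ`. -/
def apex (i : Fin Φ.numVars) (r : Fin 3) : Φ.Vertex :=
  .pyr i r ⟨(⟨0, Φ.pyramidSize_pos i r⟩, ⟨0, Φ.pyramidSize_pos i r⟩), Φ.pyramidSize_pos i r⟩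

/-- The output of the part of the graph that belongs to `xᵢ, …, xₙ₋₁` and the clauses. -/
def outFrom (i : ℕ) : Φ.Vertex :=
  if h : i < Φ.numVars then .out ⟨i, h⟩ else .chk (Fin.last _)

/-- The vertex below the literal `xᵢ` (`b = true`) or its negation (`b = false`). It is the apex of
a pyramid, except below the negative literal of an existential variable. -/
def belowLit (i : Fin Φ.numVars) (b : Bool) : Φ.Vertex :=
  if h : Φ.quant i = Quantifier.ex then
    (if b then Φ.apex i 0 else .bar i h)
  else
    (if b then Φ.apex i 2 else Φ.apex i 0)

/-- The direct predecessors of a vertex. -/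
def preds : Φ.Vertex → Set Φ.Vertex
  | .pyr i r v => {u | ∃ w, w.Adj v ∧ u = .pyr i r w}
  | .lit i b => {Φ.belowLit i b}
  | .bar i _ => {Φ.apex i 0, Φ.apex i 2}
  | .wit i =>
    match Φ.quant i with
    | .ex => {Φ.outFrom (i.val + 1), Φ.apex i 1, .lit i true, .lit i false}
    | .all => {Φ.outFrom (i.val + 1), Φ.apex i 1, .lit i true, Φ.belowLit i false}
  | .out i =>
    match Φ.quant i with
    | .ex => {.wit i, Φ.belowLit i false}
    | .all => {Φ.outFrom (i.val + 1), .wit i, Φ.belowLit i true, .lit i false}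
  | .chk j => {u | ∃ c : Fin Φ.numClauses, j = c.succ ∧
      (u = .chk c.castSucc ∨ (∃ l ∈ (Φ.clauses.get c).1, u = .lit l.1 l.2) ∨ ∃ k, u = .pad c k)}
  | .pad _ _ => ∅

/-- The graph of Gilbert, Lengauer and Tarjan; its output is `Φ.outFrom 0`. -/
def gltGraph : Digraph Φ.Vertex where
  Adj u v := u ∈ Φ.preds v

end QCNF

/-! ### The diamond and the graph for the spooky pebble game -/

/-- The `k × k` diamond, with input `(0, 0)` and output `(k - 1, k - 1)`: each vertex has an edge to
the next vertex in either coordinate. -/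
def diamond (k : ℕ) : Digraph (Fin k × Fin k) where
  Adj u v := (u.1.val + 1 = v.1.val ∧ u.2 = v.2) ∨ (u.1 = v.1 ∧ u.2.val + 1 = v.2.val)

/-- The vertices of the diamond other than its input. -/
abbrev DiamondInner (k : ℕ) := {v : Fin k × Fin k // ¬ (v.1.val = 0 ∧ v.2.val = 0)}

/-- The graph obtained from `G` and the `k × k` diamond by identifying the vertex `q` of `G` with
the input of the diamond. -/
def attachDiamond {V : Type*} (G : Digraph V) (q : V) (k : ℕ) : Digraph (V ⊕ DiamondInner k) where
  Adj
    | .inl u, .inl v => G.Adj u v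
    | .inl u, .inr v => u = q ∧ ∃ o : Fin k × Fin k,
        o.1.val = 0 ∧ o.2.val = 0 ∧ (diamond k).Adj o v.1
    | .inr u, .inr v => (diamond k).Adj u.1 v.1
    | .inr _, .inl _ => False

namespace QCNF

abbrev SpookyVertex (Φ : QCNF) := Φ.Vertex ⊕ DiamondInner (3 * Φ.numVars + 4)

/-- The diamond of size `3 n + 4` on top of the output of the graph of Gilbert, Lengauer and
Tarjan. -/
def spookyGraph (Φ : QCNF) : Digraph Φ.SpookyVertex :=
  attachDiamond Φ.gltGraph (Φ.outFrom 0) (3 * Φ.numVars + 4)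

end QCNF

/-!
A pyramid that is closed, meaning that each of its paths carries a pebble, was last open at a moment
when some path from a source to the apex was free, and the disjoint grid lines that meet this path
carry as many pebbles as the pyramid has rows. The pyramid sizes are such that these pebbles leave
no freedom: in a black pebbling of the output with `3 n + 4` pebbles, the literals that are pebbled
when the clauses are checked encode an assignment, and the block of a universal variable makes the
rest of the graph be pebbled under both of its values. So such a pebbling evaluates the formula
quantifier by quantifier, and conversely the truth of the formula is turned into a pebbling.

The diamond of size `k = 3 n + 4` makes ghosts useless. When its upper half is closed for the last
time in a spooky pebbling with `k + 1` pebbles, there are `k` pebbles on it and one just below it,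
so the rest of the graph is empty. The vertex below must later be unpebbled, for which the input of
the diamond has to be pebbled again, while at least one of the pebbles stays on the upper half: this
is a black pebbling with `k` pebbles. Conversely, a black pebbling with `k` pebbles lets one pebble
the output of the diamond, with ghosts in place of removals, and the ghosts are then removed from
the top down, since every other vertex can be pebbled with `k` pebbles beside the one on the output.
-/

/-! ### Free paths through a triangular grid -/

section Grid

variable {V : Type*} {G : Digraph V}

/-- `φ a b` with `a + b < r` are the vertices of a triangular grid of `r` rows in the digraph `G`:
row `l` consists of the `l + 1` positions with `a + b = l`, row `0` is the apex and the edges lead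
from each row to the row before it. The values of `φ` outside the grid do not matter. -/
structure IsGrid (G : Digraph V) (φ : ℕ → ℕ → V) (r : ℕ) : Prop where
  inj : ∀ a b a' b', a + b < r → a' + b' < r → φ a b = φ a' b' → a = a' ∧ b = b'
  adj_left : ∀ a b, a + b + 1 < r → G.Adj (φ (a + 1) b) (φ a b)
  adj_right : ∀ a b, a + b + 1 < r → G.Adj (φ a (b + 1)) (φ a b)

/-- A path through a triangular grid, read from the apex: `p l` is the first coordinate of its
vertex in row `l`. -/
structure IsGridPath (p : ℕ → ℕ) : Prop where
  zero : p 0 = 0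
  step : ∀ l, p (l + 1) = p l ∨ p (l + 1) = p l + 1

/-- The vertex in row `l` of the path `p` through the grid `φ`. -/
def gridPathVertex (φ : ℕ → ℕ → V) (p : ℕ → ℕ) (l : ℕ) : V := φ (p l) (l - p l)

/-- The path `p` carries no pebble in the rows `1, …, r - 1`. -/
def GridPathFree (φ : ℕ → ℕ → V) (r : ℕ) (p : ℕ → ℕ) (P : Finset V) : Prop :=
  ∀ l, 0 < l → l < r → gridPathVertex φ p l ∉ P

/-- Some path is free of pebbles in the rows `1, …, r - 1` of the grid `φ`, and so is the set `F`,
which is meant to lie on top of the grid. -/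
def GridOpen (φ : ℕ → ℕ → V) (r : ℕ) (F : Set V) (P : Finset V) : Prop :=
  (∃ p, IsGridPath p ∧ GridPathFree φ r p P) ∧ ∀ x ∈ F, x ∉ P

/-- The vertices of `F` can be pebbled only after row `1` of the grid `φ` or another vertex of `F`:
each has a predecessor in `F` or the two vertices of row `1` as predecessors. -/
def IsGridCap (G : Digraph V) (φ : ℕ → ℕ → V) (F : Set V) : Prop :=
  ∀ v ∈ F, (∃ u ∈ F, G.Adj u v) ∨ (G.Adj (φ 0 1) v ∧ G.Adj (φ 1 0) v)

variable {φ : ℕ → ℕ → V} {r : ℕ} {p : ℕ → ℕ} {F : Set V} {Q : Finset V} {v : V}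

theorem IsGridPath.le (hp : IsGridPath p) (l : ℕ) : p l ≤ l := by
  induction l with
  | zero => exact hp.zero.le
  | succ l ih => rcases hp.step l with h | h <;> omega

theorem IsGridPath.min_const (hp : IsGridPath p) (c : ℕ) : IsGridPath fun l => min (p l) c where
  zero := by simp [hp.zero]
  step l := by have := hp.step l; omega

theorem IsGridPath.max_sub_const (hp : IsGridPath p) (d : ℕ) :
    IsGridPath fun l => max (p l) (l - d) where
  zero := by simp [hp.zero]
  step l := by have := hp.step l; have := hp.le l; omega

theorem GridPathFree.anti {Q' : Finset V} (h : GridPathFree φ r p Q) (hs : Q' ⊆ Q) :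
    GridPathFree φ r p Q' :=
  fun l hl hl' hm => h l hl hl' (hs hm)

theorem GridOpen.of_forall_notMem (h : ∀ a b, 0 < a + b → a + b < r → φ a b ∉ Q)
    (hF : ∀ x ∈ F, x ∉ Q) : GridOpen φ r F Q :=
  ⟨⟨fun _ => 0, ⟨rfl, fun _ => .inl rfl⟩, fun l hl hl' => h 0 l (by omega) (by omega)⟩, hF⟩

theorem IsGridCap.notMem_of_gridOpen (hF : IsGridCap G φ F) (hr : 2 ≤ r) (ho : GridOpen φ r F Q)
    (hv : ∀ u, G.Adj u v → u ∈ Q) : v ∉ F := by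
  obtain ⟨⟨p, hp, hfree⟩, hFQ⟩ := ho
  intro hvF
  rcases hF v hvF with ⟨u, huF, hu⟩ | ⟨h₁, h₂⟩
  · exact hFQ u huF (hv u hu)
  · have hrow : gridPathVertex φ p 1 ∉ Q := hfree 1 one_pos hr
    rcases hp.step 0 with h | h <;> simp only [hp.zero, zero_add] at h <;>
      simp only [gridPathVertex, h] at hrow
    · exact hrow (hv _ h₁)
    · exact hrow (hv _ h₂)

theorem exists_mem_of_not_gridPathFree (h : ¬ GridPathFree φ r p Q) :
    ∃ l, 0 < l ∧ l < r ∧ gridPathVertex φ p l ∈ Q := by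
  simpa only [GridPathFree, not_forall, not_not, exists_prop] using h

/-! ### Closing the last free path in the black pebble game -/

variable [DecidableEq V] {P : ℕ → Finset V}

/-- One move of the black pebble game: place a pebble on a vertex all of whose direct predecessors
carry pebbles, or remove any set of pebbles. -/
def BlackMove (G : Digraph V) (P P' : Finset V) : Prop :=
  (∃ v, P' = insert v P ∧ ∀ u, G.Adj u v → u ∈ P) ∨ P' ⊆ P

theorem SpookyMove.blackMove {P S P' S' : Finset V} (h : SpookyMove G P S P' S') :
    BlackMove G P P' := by
  obtain ⟨v, ⟨rfl, -, h⟩ | ⟨rfl, -, -⟩ | ⟨rfl, -⟩ | ⟨rfl, -, h⟩⟩ := h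
  · exact .inl ⟨v, by rw [Finset.union_comm, Finset.insert_eq], h⟩
  · exact .inr Finset.sdiff_subset
  · exact .inr Finset.sdiff_subset
  · exact .inl ⟨v, by rw [Finset.union_comm, Finset.insert_eq], h⟩

theorem exists_last_time {p : ℕ → Prop} {t₀ t₁ : ℕ} (h : t₀ ≤ t₁) (h₀ : p t₀) (h₁ : ¬ p t₁) :
    ∃ τ, t₀ ≤ τ ∧ τ < t₁ ∧ p τ ∧ ∀ t, τ < t → t ≤ t₁ → ¬ p t := by
  classical
  have hτ : p (Nat.findGreatest p t₁) := Nat.findGreatest_spec h h₀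
  have hne : Nat.findGreatest p t₁ ≠ t₁ := fun he => h₁ (he ▸ hτ)
  exact ⟨_, Nat.le_findGreatest h h₀, (Nat.findGreatest_le t₁).lt_of_ne hne, hτ,
    fun _ => Nat.findGreatest_is_greatest⟩

theorem exists_last_placement (hP : ∀ t, BlackMove G (P t) (P (t + 1))) {v : V} {t₀ t₁ : ℕ}
    (h : t₀ ≤ t₁) (h₀ : v ∉ P t₀) (h₁ : v ∈ P t₁) :
    ∃ τ, t₀ ≤ τ ∧ τ < t₁ ∧ (∀ u, G.Adj u v → u ∈ P τ) ∧ ∀ t, τ < t → t ≤ t₁ → v ∈ P t := by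
  obtain ⟨τ, hτ₀, hτ₁, hτ, hlast⟩ :=
    exists_last_time (p := fun t => v ∉ P t) h h₀ (not_not.mpr h₁)
  simp only [not_not] at hlast
  refine ⟨τ, hτ₀, hτ₁, ?_, hlast⟩
  have hsucc : v ∈ P (τ + 1) := hlast _ τ.lt_succ_self hτ₁
  rcases hP τ with ⟨w, hw, hpred⟩ | hsub
  · rw [hw, Finset.mem_insert] at hsucc
    obtain rfl := hsucc.resolve_right hτ
    exact hpred
  · exact absurd (hsub hsucc) hτ

/-- The positions in the rows `1, …, r - 1` of a triangular grid. -/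
def gridPositions (r : ℕ) : Finset (ℕ × ℕ) :=
  (Finset.range r ×ˢ Finset.range r).filter fun c => 0 < c.1 + c.2 ∧ c.1 + c.2 < r

/-- The vertices in the rows `1, …, r - 1` of a triangular grid. -/
def gridCells (φ : ℕ → ℕ → V) (r : ℕ) : Finset V :=
  (gridPositions r).image fun c => φ c.1 c.2

/-- The placement after time `τ` closes the grid for the last time before `t₁`: it fills a source
and leaves as many pebbles on the grid as there are sources. -/
structure IsLastClosing (G : Digraph V) (φ : ℕ → ℕ → V) (r : ℕ) (F : Set V) (P : ℕ → Finset V)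
    (τ t₁ : ℕ) : Prop where
  isOpen : GridOpen φ r F (P τ)
  closed : ∀ t, τ < t → t ≤ t₁ → ¬ GridOpen φ r F (P t)
  exists_source : ∃ a b, a + b + 1 = r ∧ P (τ + 1) = insert (φ a b) (P τ) ∧
    ∀ u, G.Adj u (φ a b) → u ∈ P τ
  card_le : r ≤ (P (τ + 1) ∩ gridCells φ r).card

theorem mem_gridPositions {a b : ℕ} : (a, b) ∈ gridPositions r ↔ 0 < a + b ∧ a + b < r := by
  simp only [gridPositions, Finset.mem_filter, Finset.mem_product, Finset.mem_range]
  omega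

theorem mem_gridCells {x : V} : x ∈ gridCells φ r ↔ ∃ a b, 0 < a + b ∧ a + b < r ∧ x = φ a b := by
  simp only [gridCells, Finset.mem_image, Prod.exists, mem_gridPositions, and_assoc, eq_comm]

theorem exists_mem_of_not_gridOpen (h : ¬ GridOpen φ r F Q) :
    ∃ x ∈ Q, x ∈ gridCells φ r ∨ x ∈ F := by
  by_contra! hc
  refine h (.of_forall_notMem (fun a b h₀ hr hm => ?_) fun x hx hm => (hc x hm).2 hx)
  exact (hc _ hm).1 (mem_gridCells.mpr ⟨a, b, h₀, hr, rfl⟩)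

theorem IsGridCap.exists_insert_of_closes (hF : IsGridCap G φ F) (hr : 2 ≤ r) {Q' : Finset V}
    (hm : BlackMove G Q Q') (ho : GridOpen φ r F Q) (hc : ¬ GridOpen φ r F Q') :
    ∃ v, Q' = insert v Q ∧ (∀ u, G.Adj u v → u ∈ Q) ∧
      ∀ p, IsGridPath p → ¬ GridPathFree φ r p Q' := by
  rcases hm with ⟨v, rfl, hv⟩ | hs
  · refine ⟨v, rfl, hv, fun p hp hfree => hc ⟨⟨p, hp, hfree⟩, fun x hx hxv => ?_⟩⟩
    rcases Finset.mem_insert.mp hxv with rfl | hxQ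
    · exact hF.notMem_of_gridOpen hr ho hv hx
    · exact ho.2 x hx hxQ
  · obtain ⟨⟨p, hp, hfree⟩, hFQ⟩ := ho
    exact absurd ⟨⟨p, hp, hfree.anti hs⟩, fun x hx hxm => hFQ x hx (hs hxm)⟩ hc

/-- The next vertex of the path is a predecessor, so it would be pebbled too. -/
theorem IsGrid.eq_source_of_mem_insert (hφ : IsGrid G φ r) (hp : IsGridPath p)
    (hfree : GridPathFree φ r p Q) (hv : ∀ u, G.Adj u v → u ∈ Q) {l : ℕ} (hl : 0 < l)
    (hlr : l < r) (hm : gridPathVertex φ p l ∈ insert v Q) :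
    l + 1 = r ∧ v = gridPathVertex φ p l := by
  obtain rfl := (Finset.mem_insert.mp hm).resolve_right (hfree l hl hlr)
  refine ⟨?_, rfl⟩
  by_contra hne
  have hle := hp.le l
  refine hfree (l + 1) l.succ_pos (by omega) (hv _ ?_)
  rcases hp.step l with h | h <;> simp only [gridPathVertex, h]
  · rw [show l + 1 - p l = l - p l + 1 by omega]
    exact hφ.adj_right _ _ (by omega)
  · rw [show l + 1 - (p l + 1) = l - p l by omega]
    exact hφ.adj_left _ _ (by omega)

/-- Off the path `p`, the source from which a straight line leads through the position `c` to
`p`; on `p`, the source of `p`. -/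
def detourSource (p : ℕ → ℕ) (r : ℕ) (c : ℕ × ℕ) : ℕ :=
  if c.1 < p (c.1 + c.2) then c.1 else if p (c.1 + c.2) < c.1 then r - 1 - c.2 else p (r - 1)

theorem IsGrid.exists_mem_detourSource_eq (hφ : IsGrid G φ r) (hp : IsGridPath p)
    (hfree : GridPathFree φ r p Q) (hv : ∀ u, G.Adj u v → u ∈ Q)
    (hblock : ∀ p', IsGridPath p' → ¬ GridPathFree φ r p' (insert v Q)) {c : ℕ} (hc : c < r) :
    ∃ a b, 0 < a + b ∧ a + b < r ∧ φ a b ∈ insert v Q ∧ detourSource p r (a, b) = c := by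
  have on_path {l a : ℕ} (hl : 0 < l) (hlr : l < r) (ha : a = p l)
      (hm : φ a (l - a) ∈ insert v Q) : l + 1 = r :=
    (hφ.eq_source_of_mem_insert hp hfree hv hl hlr (by rwa [gridPathVertex, ← ha])).1
  rcases Nat.lt_trichotomy c (p (r - 1)) with hlt | rfl | hgt
  · obtain ⟨l, hl, hlr, hm⟩ := exists_mem_of_not_gridPathFree (hblock _ (hp.min_const c))
    simp only [gridPathVertex] at hm
    have hle := hp.le l
    have hcl : c < p l := by
      by_contra! hge
      have hlast := on_path hl hlr (by omega) hm
      rw [show r - 1 = l by omega] at hlt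
      omega
    refine ⟨_, _, by omega, by omega, hm, ?_⟩
    rw [detourSource, show min (p l) c + (l - min (p l) c) = l by omega, if_pos (by omega)]
    omega
  · obtain ⟨l, hl, hlr, hm⟩ := exists_mem_of_not_gridPathFree (hblock p hp)
    have hle := hp.le l
    refine ⟨p l, l - p l, by omega, by omega, hm, ?_⟩
    rw [detourSource, show p l + (l - p l) = l by omega, if_neg (lt_irrefl _),
      if_neg (lt_irrefl _)]
  · obtain ⟨l, hl, hlr, hm⟩ :=
      exists_mem_of_not_gridPathFree (hblock _ (hp.max_sub_const (r - 1 - c)))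
    simp only [gridPathVertex] at hm
    have hle := hp.le l
    have hlc : p l < l - (r - 1 - c) := by
      by_contra! hge
      have hlast := on_path hl hlr (by omega) hm
      rw [show r - 1 = l by omega] at hgt hge
      omega
    refine ⟨_, _, by omega, by omega, hm, ?_⟩
    rw [detourSource, show max (p l) (l - (r - 1 - c)) + (l - max (p l) (l - (r - 1 - c))) = l by
      omega, if_neg (by omega), if_pos (by omega)]
    omega

/-- The straight lines from the sources to a path that was free until its source was filled are
disjoint, and each carries a pebble. -/
theorem IsGrid.card_le_of_blocked (hφ : IsGrid G φ r) (hp : IsGridPath p)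
    (hfree : GridPathFree φ r p Q) (hv : ∀ u, G.Adj u v → u ∈ Q)
    (hblock : ∀ p', IsGridPath p' → ¬ GridPathFree φ r p' (insert v Q)) :
    r ≤ (insert v Q ∩ gridCells φ r).card := by
  let S := (gridPositions r).filter fun c => φ c.1 c.2 ∈ insert v Q
  have hsurj : Set.SurjOn (detourSource p r) S (Finset.range r) := by
    intro c hc
    obtain ⟨a, b, h₀, hab, hm, rfl⟩ :=
      hφ.exists_mem_detourSource_eq hp hfree hv hblock (Finset.mem_range.mp hc)
    exact ⟨(a, b), Finset.mem_filter.mpr ⟨mem_gridPositions.mpr ⟨h₀, hab⟩, hm⟩, rfl⟩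
  calc r = (Finset.range r).card := (Finset.card_range r).symm
    _ ≤ S.card := Finset.card_le_card_of_surjOn _ hsurj
    _ ≤ _ := Finset.card_le_card_of_injOn (fun c => φ c.1 c.2) ?_ ?_
  · intro c hc
    obtain ⟨hc, hm⟩ := Finset.mem_filter.mp hc
    exact Finset.mem_inter.mpr ⟨hm, Finset.mem_image_of_mem _ hc⟩
  · rintro ⟨a, b⟩ hc ⟨a', b'⟩ hc' he
    have hab := mem_gridPositions.mp (Finset.mem_filter.mp hc).1
    have hab' := mem_gridPositions.mp (Finset.mem_filter.mp hc').1
    exact Prod.ext_iff.mpr (hφ.inj a b a' b' hab.2 hab'.2 he)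

theorem IsGrid.exists_isLastClosing (hφ : IsGrid G φ r) (hF : IsGridCap G φ F) (hr : 2 ≤ r)
    (hP : ∀ t, BlackMove G (P t) (P (t + 1))) {t₀ t₁ : ℕ} (h : t₀ ≤ t₁)
    (ho : GridOpen φ r F (P t₀)) (hc : ¬ GridOpen φ r F (P t₁)) :
    ∃ τ, t₀ ≤ τ ∧ τ < t₁ ∧ IsLastClosing G φ r F P τ t₁ := by
  obtain ⟨τ, hτ₀, hτ₁, hopen, hclosed⟩ :=
    exists_last_time (p := fun t => GridOpen φ r F (P t)) h ho hc
  obtain ⟨v, hins, hv, hblock⟩ :=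
    hF.exists_insert_of_closes hr (hP τ) hopen (hclosed _ τ.lt_succ_self hτ₁)
  obtain ⟨p, hp, hfree⟩ := hopen.1
  rw [hins] at hblock
  obtain ⟨l, hl, hlr, hm⟩ := exists_mem_of_not_gridPathFree (hblock p hp)
  obtain ⟨hlast, rfl⟩ := hφ.eq_source_of_mem_insert hp hfree hv hl hlr hm
  have hle := hp.le l
  exact ⟨τ, hτ₀, hτ₁, hopen, hclosed, ⟨p l, l - p l, by omega, hins, hv⟩,
    hins ▸ hφ.card_le_of_blocked hp hfree hv hblock⟩

theorem IsLastClosing.subset {τ t₁ : ℕ} (h : IsLastClosing G φ r F P τ t₁) :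
    P τ ⊆ P (τ + 1) := by
  obtain ⟨a, b, -, hins, -⟩ := h.exists_source
  exact hins ▸ Finset.subset_insert _ _

end Grid

/-! ### Truth of a quantified formula, variable by variable -/

section Truth

variable {N : ℕ}

/-- Truth of `Qᵢ xᵢ … F` under an assignment of the variables before `xᵢ`. The other values of the
assignment do not matter. -/
def TrueFrom (Q : Fin N → Quantifier) (F : (Fin N → Bool) → Prop) (i : ℕ) (σ : Fin N → Bool) :
    Prop :=
  if h : i < N then
    match Q ⟨i, h⟩ with
    | .all => ∀ b, TrueFrom Q F (i + 1) (Function.update σ ⟨i, h⟩ b)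
    | .ex => ∃ b, TrueFrom Q F (i + 1) (Function.update σ ⟨i, h⟩ b)
  else F σ
termination_by N - i

variable {Q : Fin N → Quantifier} {F : (Fin N → Bool) → Prop} {i : ℕ} {σ : Fin N → Bool}

theorem trueFrom_of_le (h : N ≤ i) : TrueFrom Q F i σ ↔ F σ := by
  rw [TrueFrom, dif_neg (by omega)]

theorem trueFrom_all (h : i < N) (hQ : Q ⟨i, h⟩ = .all) :
    TrueFrom Q F i σ ↔ ∀ b, TrueFrom Q F (i + 1) (Function.update σ ⟨i, h⟩ b) := by
  conv_lhs => rw [TrueFrom, dif_pos h, hQ]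

theorem trueFrom_ex (h : i < N) (hQ : Q ⟨i, h⟩ = .ex) :
    TrueFrom Q F i σ ↔ ∃ b, TrueFrom Q F (i + 1) (Function.update σ ⟨i, h⟩ b) := by
  conv_lhs => rw [TrueFrom, dif_pos h, hQ]

theorem trueFrom_succ_cons {Q : Fin (N + 1) → Quantifier} {F : (Fin (N + 1) → Bool) → Prop}
    (b : Bool) (i : ℕ) (σ : Fin N → Bool) :
    TrueFrom Q F (i + 1) (Fin.cons b σ) ↔
      TrueFrom (fun j => Q j.succ) (fun τ => F (Fin.cons b τ)) i σ := by
  rcases Nat.lt_or_ge i N with h | h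
  · have hupdate (c : Bool) :
        Function.update (Fin.cons b σ : Fin (N + 1) → Bool) ⟨i + 1, Nat.succ_lt_succ h⟩ c =
          Fin.cons b (Function.update σ ⟨i, h⟩ c) :=
      (Fin.cons_update (α := fun _ => Bool) b σ ⟨i, h⟩ c).symm
    rcases hQ : Q (Fin.succ ⟨i, h⟩) with _ | _
    · rw [trueFrom_all (Nat.succ_lt_succ h) hQ, trueFrom_all h hQ]
      simp only [hupdate, trueFrom_succ_cons b (i + 1)]
    · rw [trueFrom_ex (Nat.succ_lt_succ h) hQ, trueFrom_ex h hQ]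
      simp only [hupdate, trueFrom_succ_cons b (i + 1)]
  · rw [trueFrom_of_le h, trueFrom_of_le (Nat.succ_le_succ h)]
termination_by N - i

theorem quantTrue_iff_trueFrom (σ : Fin N → Bool) : QuantTrue N Q F ↔ TrueFrom Q F 0 σ := by
  induction N with
  | zero => rw [QuantTrue, trueFrom_of_le le_rfl, Subsingleton.elim σ Fin.elim0]
  | succ N ih =>
    have hupdate (b : Bool) : Function.update σ 0 b = Fin.cons b (Fin.tail σ) := by
      rw [← Fin.cons_self_tail σ, Fin.update_cons_zero, Fin.tail_cons]
    rw [QuantTrue]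
    rcases hQ : Q 0 with _ | _
    · simp only [trueFrom_all N.succ_pos hQ, Fin.zero_eta, hupdate, trueFrom_succ_cons,
        ih (Fin.tail σ)]
    · simp only [trueFrom_ex N.succ_pos hQ, Fin.zero_eta, hupdate, trueFrom_succ_cons,
        ih (Fin.tail σ)]

theorem trueFrom_iff_exists (i : ℕ) (σ : Fin N → Bool) (hi : ∀ j : Fin N, i ≤ j.val → Q j = .ex) :
    TrueFrom Q F i σ ↔ ∃ τ, (∀ j : Fin N, j.val < i → τ j = σ j) ∧ F τ := by
  rcases Nat.lt_or_ge i N with h | h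
  · simp only [trueFrom_ex h (hi _ le_rfl),
      fun b => trueFrom_iff_exists (i + 1) (Function.update σ ⟨i, h⟩ b) fun j hj => hi j (by omega)]
    constructor
    · rintro ⟨b, τ, hτ, hF⟩
      refine ⟨τ, fun j hj => ?_, hF⟩
      rw [hτ j (by omega), Function.update_of_ne (Fin.ne_of_lt hj)]
    · rintro ⟨τ, hτ, hF⟩
      refine ⟨τ ⟨i, h⟩, τ, fun j hj => ?_, hF⟩
      rcases eq_or_ne j ⟨i, h⟩ with rfl | hne
      · rw [Function.update_self]
      · rw [Function.update_of_ne hne]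
        exact hτ j (Nat.lt_of_le_of_ne (Nat.le_of_lt_succ hj) (Fin.val_ne_of_ne hne))
  · rw [trueFrom_of_le h]
    exact ⟨fun hF => ⟨σ, fun _ _ => rfl, hF⟩,
      fun ⟨τ, hτ, hF⟩ => (funext fun j => hτ j (by omega) : τ = σ) ▸ hF⟩
termination_by N - i

variable {n a : ℕ} {R : Fin n → Quantifier} {F : (Fin (n + a) → Bool) → Prop}

theorem trueFrom_append_self (σ : Fin (n + a) → Bool) :
    TrueFrom (Fin.append R fun _ => .ex) F n σ ↔
      ∃ τ : Fin a → Bool, F (Fin.append (fun j => σ (j.castAdd a)) τ) := by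
  rw [trueFrom_iff_exists]
  · constructor
    · rintro ⟨τ, hτ, hF⟩
      have hσ : (fun j : Fin n => σ (j.castAdd a)) = fun j => τ (j.castAdd a) :=
        funext fun j => (hτ _ j.isLt).symm
      exact ⟨fun j => τ (j.natAdd n), by rwa [hσ, Fin.append_castAdd_natAdd]⟩
    · rintro ⟨τ, hF⟩
      exact ⟨_, fun j hj => Fin.append_left _ _ (⟨j, hj⟩ : Fin n), hF⟩
  · intro j hj
    obtain ⟨k, rfl⟩ : ∃ k : Fin a, j = k.natAdd n :=
      ⟨⟨j - n, by omega⟩, Fin.ext (by simp only [Fin.val_natAdd]; omega)⟩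
    exact Fin.append_right _ _ k

theorem trueFrom_append (i : ℕ) (hi : i ≤ n) (σ : Fin (n + a) → Bool) :
    TrueFrom (Fin.append R fun _ => .ex) F i σ ↔
      TrueFrom R (fun ρ => ∃ τ, F (Fin.append ρ τ)) i (fun j => σ (j.castAdd a)) := by
  rcases hi.lt_or_eq with h | rfl
  · have h' : i < n + a := by omega
    have hquant : Fin.append R (fun _ : Fin a => Quantifier.ex) ⟨i, h'⟩ = R ⟨i, h⟩ :=
      Fin.append_left (n := a) R (fun _ => Quantifier.ex) ⟨i, h⟩
    have hupdate (b : Bool) : (fun j : Fin n => Function.update σ ⟨i, h'⟩ b (j.castAdd a)) =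
        Function.update (fun j => σ (j.castAdd a)) ⟨i, h⟩ b := by
      funext j
      simp only [Function.update_apply, Fin.ext_iff, Fin.val_castAdd]
    rcases hR : R ⟨i, h⟩ with _ | _
    · rw [trueFrom_all h' (hquant.trans hR), trueFrom_all h hR]
      simp only [trueFrom_append (i + 1) h, hupdate]
    · rw [trueFrom_ex h' (hquant.trans hR), trueFrom_ex h hR]
      simp only [trueFrom_append (i + 1) h, hupdate]
  · rw [trueFrom_append_self, trueFrom_of_le le_rfl]
termination_by n - i

end Truth

/-! ### Correctness of the clausal form -/

namespace BoolFormula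

/-- The assignment `ρ` satisfies all clauses of the list `L`. -/
def SatAll {N : ℕ} (ρ : Fin N → Bool) (L : List (Clause N)) : Prop :=
  ∀ c ∈ L, ∃ l ∈ c.1, ρ l.1 = l.2

/-- The values under the assignment `σ` of the subformulas that the new variables of the clausal
form stand for. -/
def auxVal {n : ℕ} (σ : Fin n → Bool) : (φ : BoolFormula n) → Fin φ.auxCount → Bool
  | const b => fun _ => b
  | var _ => Fin.elim0
  | neg φ => φ.auxVal σ
  | and φ ψ => Fin.snoc (Fin.append (φ.auxVal σ) (ψ.auxVal σ)) ((and φ ψ).eval σ)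
  | or φ ψ => Fin.snoc (Fin.append (φ.auxVal σ) (ψ.auxVal σ)) ((or φ ψ).eval σ)

variable {n N : ℕ} {ρ : Fin N → Bool}

theorem sat_clause_of {a b c : Literal N} :
    (∃ l ∈ (Clause.of a b c).1, ρ l.1 = l.2) ↔ ρ a.1 = a.2 ∨ ρ b.1 = b.2 ∨ ρ c.1 = c.2 := by
  simp [Clause.of]

theorem satAll_nil : SatAll ρ [] := fun _ hc => absurd hc List.not_mem_nil

theorem satAll_cons {c : Clause N} {L : List (Clause N)} :
    SatAll ρ (c :: L) ↔ (∃ l ∈ c.1, ρ l.1 = l.2) ∧ SatAll ρ L :=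
  List.forall_mem_cons

theorem satAll_append {L L' : List (Clause N)} :
    SatAll ρ (L ++ L') ↔ SatAll ρ L ∧ SatAll ρ L' :=
  List.forall_mem_append

theorem sat_not {l : Literal N} : ρ l.not.1 = l.not.2 ↔ ¬ ρ l.1 = l.2 :=
  Bool.eq_not

theorem forall_eq_snoc_append {α : Type*} {p q : ℕ} {y : Fin (p + q + 1) → α} {f : Fin p → α}
    {g : Fin q → α} {z : α} :
    (∀ j, y j = (Fin.snoc (Fin.append f g) z : Fin (p + q + 1) → α) j) ↔
      (∀ j, y (j.castAdd q).castSucc = f j) ∧ (∀ j, y (j.natAdd p).castSucc = g j) ∧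
        y (Fin.last _) = z := by
  simp only [Fin.forall_fin_succ', Fin.forall_fin_add, Fin.snoc_castSucc, Fin.snoc_last,
    Fin.append_left, Fin.append_right, and_assoc]

theorem sat_tseitin_iff_of_satAll (x : Fin n → Fin N) (φ : BoolFormula n)
    (y : Fin φ.auxCount → Fin N) (h : SatAll ρ (φ.tseitin x y).2) :
    ρ (φ.tseitin x y).1.1 = (φ.tseitin x y).1.2 ↔ φ.eval (ρ ∘ x) = true := by
  induction φ with
  | const b =>
    simp only [tseitin, satAll_cons, sat_clause_of, or_self, eval] at h ⊢
    rw [h.1]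
  | var i => rfl
  | neg φ ih =>
    simp only [tseitin] at h ⊢
    rw [sat_not, ih y h, eval, Bool.not_eq_true', Bool.not_eq_true]
  | and φ ψ ihφ ihψ =>
    simp only [tseitin, satAll_cons, satAll_append, sat_clause_of, sat_not] at h ⊢
    obtain ⟨hzφ, hzψ, hz, hφ, hψ⟩ := h
    rw [ihφ _ hφ] at hzφ hz
    rw [ihψ _ hψ] at hzψ hz
    simp only [eval, Bool.and_eq_true]
    tauto
  | or φ ψ ihφ ihψ =>
    simp only [tseitin, satAll_cons, satAll_append, sat_clause_of, sat_not] at h ⊢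
    obtain ⟨hφz, hψz, hz, hφ, hψ⟩ := h
    rw [ihφ _ hφ] at hφz hz
    rw [ihψ _ hψ] at hψz hz
    simp only [eval, Bool.or_eq_true]
    tauto

theorem satAll_tseitin (x : Fin n → Fin N) (φ : BoolFormula n) (y : Fin φ.auxCount → Fin N)
    (h : ∀ j, ρ (y j) = φ.auxVal (ρ ∘ x) j) : SatAll ρ (φ.tseitin x y).2 := by
  induction φ with
  | const b =>
    simp only [tseitin, satAll_cons, sat_clause_of, or_self]
    exact ⟨h _, satAll_nil⟩
  | var i => exact satAll_nil
  | neg φ ih => exact ih y h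
  | and φ ψ ihφ ihψ | or φ ψ ihφ ihψ =>
    obtain ⟨hyφ, hyψ, hz⟩ := forall_eq_snoc_append.mp h
    have hφ := ihφ _ hyφ
    have hψ := ihψ _ hyψ
    simp only [eval] at hz
    simp only [tseitin, satAll_cons, satAll_append, sat_clause_of, sat_not, hφ, hψ, hz,
      sat_tseitin_iff_of_satAll x _ _ hφ, sat_tseitin_iff_of_satAll x _ _ hψ]
    cases eval (ρ ∘ x) φ <;> cases eval (ρ ∘ x) ψ <;> decide

theorem auxCount_le_size (φ : BoolFormula n) : φ.auxCount ≤ φ.size := by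
  induction φ <;> simp only [auxCount, size] <;> omega

theorem length_tseitin_le (x : Fin n → Fin N) (φ : BoolFormula n) (y : Fin φ.auxCount → Fin N) :
    (φ.tseitin x y).2.length ≤ 3 * φ.size := by
  induction φ with
  | const b => simp [tseitin, size]
  | var i => simp [tseitin]
  | neg φ ih =>
    have := ih y
    simp only [tseitin, size]
    omega
  | and φ ψ ihφ ihψ | or φ ψ ihφ ihψ =>
    have := ihφ fun i => y (i.castAdd ψ.auxCount).castSucc
    have := ihψ fun i => y (i.natAdd φ.auxCount).castSucc
    simp only [tseitin, size, List.length_cons, List.length_append]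
    omega

theorem size_pos (φ : BoolFormula n) : 0 < φ.size := by
  cases φ <;> exact Nat.succ_pos _

end BoolFormula

namespace QBF

open BoolFormula

theorem exists_satAll_toQCNF_iff (F : QBF) (σ : Fin F.numVars → Bool) :
    (∃ τ, SatAll (Fin.append σ τ) F.toQCNF.clauses) ↔ F.matrix.eval σ = true := by
  have hcomp (τ : Fin F.matrix.auxCount → Bool) :
      Fin.append σ τ ∘ Fin.castAdd F.matrix.auxCount = σ := funext (Fin.append_left σ τ)
  simp only [QBF.toQCNF, satAll_cons, sat_clause_of, or_self]
  constructor
  · rintro ⟨τ, hz, hdef⟩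
    rwa [sat_tseitin_iff_of_satAll _ _ _ hdef, hcomp] at hz
  · intro h
    have hdef : SatAll (Fin.append σ (F.matrix.auxVal σ)) _ :=
      satAll_tseitin (Fin.castAdd F.matrix.auxCount) F.matrix (Fin.natAdd F.numVars) fun j => by
        rw [hcomp, Fin.append_right]
    exact ⟨_, by rwa [sat_tseitin_iff_of_satAll _ _ _ hdef, hcomp], hdef⟩

theorem isTrue_toQCNF (F : QBF) : F.toQCNF.IsTrue ↔ F.IsTrue := by
  rw [QCNF.IsTrue, QBF.IsTrue, quantTrue_iff_trueFrom (fun _ => false),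
    quantTrue_iff_trueFrom (fun _ => false)]
  exact (trueFrom_append 0 F.numVars.zero_le _).trans
    (iff_of_eq (congrArg (TrueFrom F.quant · 0 _)
      (funext fun σ => propext (F.exists_satAll_toQCNF_iff σ))))

theorem size_toQCNF_le (F : QBF) : F.toQCNF.size ≤ 6 * F.size := by
  have := F.matrix.auxCount_le_size
  have := F.matrix.size_pos
  have := length_tseitin_le (Fin.castAdd F.matrix.auxCount) F.matrix (Fin.natAdd F.numVars)
  simp only [QCNF.size, QCNF.numClauses, QBF.toQCNF, QBF.size, List.length_cons]
  omega

end QBF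

/-! ### The structure of the graph -/

theorem isAcyclic_of_rank {V : Type*} {G : Digraph V} (f : V → ℕ)
    (h : ∀ u v, G.Adj u v → f u < f v) : G.IsAcyclic := by
  intro v hv
  have hlt : Relation.TransGen (· < ·) (f v) (f v) := hv.lift f h
  rw [Relation.transGen_eq_self] at hlt
  exact lt_irrefl _ hlt

namespace QCNF

variable {Φ : QCNF} {i : Fin Φ.numVars} {u : Φ.Vertex}

theorem outFrom_of_lt {i : ℕ} (h : i < Φ.numVars) : Φ.outFrom i = .out ⟨i, h⟩ := dif_pos h

theorem outFrom_of_le {i : ℕ} (h : Φ.numVars ≤ i) : Φ.outFrom i = .chk (Fin.last _) :=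
  dif_neg h.not_gt

theorem belowLit_ex_true (h : Φ.quant i = .ex) : Φ.belowLit i true = Φ.apex i 0 := by
  rw [belowLit, dif_pos h, if_pos rfl]

theorem belowLit_ex_false (h : Φ.quant i = .ex) : Φ.belowLit i false = .bar i h := by
  rw [belowLit, dif_pos h, if_neg Bool.false_ne_true]

theorem belowLit_all_true (h : Φ.quant i = .all) : Φ.belowLit i true = Φ.apex i 2 := by
  rw [belowLit, dif_neg (by simp [h]), if_pos rfl]

theorem belowLit_all_false (h : Φ.quant i = .all) : Φ.belowLit i false = Φ.apex i 0 := by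
  rw [belowLit, dif_neg (by simp [h]), if_neg Bool.false_ne_true]

theorem adj_pyr_iff {r : Fin 3} {v : PyramidVertex (Φ.pyramidSize i r)} :
    Φ.gltGraph.Adj u (.pyr i r v) ↔ ∃ w, w.Adj v ∧ u = .pyr i r w := Iff.rfl

theorem adj_lit_iff {b : Bool} : Φ.gltGraph.Adj u (.lit i b) ↔ u = Φ.belowLit i b := Iff.rfl

theorem adj_bar_iff {h : Φ.quant i = .ex} :
    Φ.gltGraph.Adj u (.bar i h) ↔ u = Φ.apex i 0 ∨ u = Φ.apex i 2 := Iff.rfl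

theorem adj_wit_ex_iff (h : Φ.quant i = .ex) :
    Φ.gltGraph.Adj u (.wit i) ↔
      u = Φ.outFrom (i.val + 1) ∨ u = Φ.apex i 1 ∨ u = .lit i true ∨ u = .lit i false := by
  simp only [gltGraph, preds, h]
  rfl

theorem adj_wit_all_iff (h : Φ.quant i = .all) :
    Φ.gltGraph.Adj u (.wit i) ↔
      u = Φ.outFrom (i.val + 1) ∨ u = Φ.apex i 1 ∨ u = .lit i true ∨ u = Φ.apex i 0 := by
  rw [← belowLit_all_false h]
  simp only [gltGraph, preds, h]
  rfl

theorem adj_out_ex_iff (h : Φ.quant i = .ex) :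
    Φ.gltGraph.Adj u (.out i) ↔ u = .wit i ∨ u = .bar i h := by
  rw [← belowLit_ex_false h]
  simp only [gltGraph, preds, h]
  rfl

theorem adj_out_all_iff (h : Φ.quant i = .all) :
    Φ.gltGraph.Adj u (.out i) ↔
      u = Φ.outFrom (i.val + 1) ∨ u = .wit i ∨ u = Φ.apex i 2 ∨ u = .lit i false := by
  rw [← belowLit_all_true h]
  simp only [gltGraph, preds, h]
  rfl

theorem adj_chk_succ_iff {c : Fin Φ.numClauses} :
    Φ.gltGraph.Adj u (.chk c.succ) ↔ u = .chk c.castSucc ∨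
      (∃ l ∈ (Φ.clauses.get c).1, u = .lit l.1 l.2) ∨ ∃ k, u = .pad c k := by
  constructor
  · rintro ⟨c', hc, h⟩
    obtain rfl := Fin.succ_injective _ hc
    exact h
  · exact fun h => ⟨c, rfl, h⟩

theorem not_adj_chk_zero : ¬ Φ.gltGraph.Adj u (.chk 0) := by
  rintro ⟨c, hc, -⟩
  exact Fin.succ_ne_zero c hc.symm

theorem not_adj_pad {c : Fin Φ.numClauses} {k : Fin (3 - (Φ.clauses.get c).1.card)} :
    ¬ Φ.gltGraph.Adj u (.pad c k) := id

theorem outFrom_succ_adj_wit (i : Fin Φ.numVars) :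
    Φ.gltGraph.Adj (Φ.outFrom (i.val + 1)) (.wit i) := by
  rcases h : Φ.quant i with _ | _
  · exact (adj_wit_all_iff h).mpr (.inl rfl)
  · exact (adj_wit_ex_iff h).mpr (.inl rfl)

theorem apex_one_adj_wit (i : Fin Φ.numVars) : Φ.gltGraph.Adj (Φ.apex i 1) (.wit i) := by
  rcases h : Φ.quant i with _ | _
  · exact (adj_wit_all_iff h).mpr (.inr (.inl rfl))
  · exact (adj_wit_ex_iff h).mpr (.inr (.inl rfl))

theorem lit_true_adj_wit (i : Fin Φ.numVars) : Φ.gltGraph.Adj (.lit i true) (.wit i) := by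
  rcases h : Φ.quant i with _ | _
  · exact (adj_wit_all_iff h).mpr (.inr (.inr (.inl rfl)))
  · exact (adj_wit_ex_iff h).mpr (.inr (.inr (.inl rfl)))

theorem wit_adj_out (i : Fin Φ.numVars) : Φ.gltGraph.Adj (.wit i) (.out i) := by
  rcases h : Φ.quant i with _ | _
  · exact (adj_out_all_iff h).mpr (.inr (.inl rfl))
  · exact (adj_out_ex_iff h).mpr (.inl rfl)

/-- A rank that increases along the edges of the graph. -/
def rank : Φ.Vertex → ℕ
  | .pyr i r v => Φ.pyramidSize i r - (v.1.1.val + v.1.2.val)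
  | .bar _ _ => 3 * Φ.numVars + 4
  | .lit _ _ => 3 * Φ.numVars + 5
  | .pad _ _ => 0
  | .chk j => 3 * Φ.numVars + 6 + j
  | .wit i => 3 * Φ.numVars + 6 + Φ.numClauses + 2 * (Φ.numVars - i)
  | .out i => 3 * Φ.numVars + 7 + Φ.numClauses + 2 * (Φ.numVars - i)

theorem rank_apex_le (i : Fin Φ.numVars) (r : Fin 3) : rank (Φ.apex i r) ≤ 3 * Φ.numVars + 3 := by
  simp only [rank, apex, pyramidSize]
  omega

theorem rank_belowLit_le (i : Fin Φ.numVars) (b : Bool) :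
    rank (Φ.belowLit i b) ≤ 3 * Φ.numVars + 4 := by
  unfold belowLit
  split_ifs
  · exact (rank_apex_le i 0).trans (Nat.le_succ _)
  · exact le_rfl
  · exact (rank_apex_le i 2).trans (Nat.le_succ _)
  · exact (rank_apex_le i 0).trans (Nat.le_succ _)

theorem rank_outFrom_succ_lt (i : Fin Φ.numVars) :
    rank (Φ.outFrom (i.val + 1)) < rank (.wit i : Φ.Vertex) := by
  unfold outFrom
  split_ifs
  · simp only [rank]
    omega
  · simp only [rank, Fin.val_last]
    omega

theorem rank_lt_of_adj {u v : Φ.Vertex} (h : Φ.gltGraph.Adj u v) : rank u < rank v := by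
  rcases v with ⟨i, r, v⟩ | ⟨i, b⟩ | ⟨i, hi⟩ | i | i | j | ⟨j, k⟩
  · obtain ⟨w, hw, rfl⟩ := adj_pyr_iff.mp h
    have := w.2
    have := v.2
    simp only [rank]
    rcases hw with ⟨_, h⟩ | ⟨h, _⟩ <;> have := congrArg Fin.val h <;> omega
  · exact adj_lit_iff.mp h ▸ Nat.lt_succ_of_le (rank_belowLit_le i b)
  · rcases adj_bar_iff.mp h with rfl | rfl <;> exact Nat.lt_succ_of_le (rank_apex_le i _)
  · have hout := rank_outFrom_succ_lt i
    have hapex := rank_apex_le i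
    rcases hq : Φ.quant i with _ | _
    · rcases (adj_wit_all_iff hq).mp h with rfl | rfl | rfl | rfl <;>
        [skip; have := hapex 1; skip; have := hapex 0] <;> simp only [rank] at * <;> omega
    · rcases (adj_wit_ex_iff hq).mp h with rfl | rfl | rfl | rfl <;>
        [skip; have := hapex 1; skip; skip] <;> simp only [rank] at * <;> omega
  · have hout := rank_outFrom_succ_lt i
    have hapex := rank_apex_le i 2
    rcases hq : Φ.quant i with _ | _
    · rcases (adj_out_all_iff hq).mp h with rfl | rfl | rfl | rfl <;>
        simp only [rank] at * <;> omega
    · rcases (adj_out_ex_iff hq).mp h with rfl | rfl <;> simp only [rank] at * <;> omega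
  · obtain ⟨c, rfl, rfl | ⟨l, -, rfl⟩ | ⟨k, rfl⟩⟩ := h <;>
      simp only [rank, Fin.val_succ, Fin.val_castSucc] <;> omega
  · exact absurd h not_adj_pad

theorem isAcyclic_gltGraph : Φ.gltGraph.IsAcyclic :=
  isAcyclic_of_rank rank fun _ _ => rank_lt_of_adj

theorem pyr_reaches_apex {r : Fin 3} (a b : ℕ) (ha : a < Φ.pyramidSize i r)
    (hb : b < Φ.pyramidSize i r) (h : a + b < Φ.pyramidSize i r) :
    Relation.ReflTransGen Φ.gltGraph.Adj (.pyr i r ⟨(⟨a, ha⟩, ⟨b, hb⟩), h⟩) (Φ.apex i r) := by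
  induction a with
  | succ a ih =>
    refine .head ?_ (ih (by omega) (by omega))
    exact adj_pyr_iff.mpr ⟨⟨(⟨a + 1, ha⟩, ⟨b, hb⟩), h⟩, .inl ⟨rfl, rfl⟩, rfl⟩
  | zero =>
    induction b with
    | succ b ih =>
      refine .head ?_ (ih (by omega) (by omega))
      exact adj_pyr_iff.mpr ⟨⟨(⟨0, ha⟩, ⟨b + 1, hb⟩), h⟩, .inr ⟨rfl, rfl⟩, rfl⟩
    | zero => exact .refl

theorem outFrom_reaches (i : ℕ) (hi : i ≤ Φ.numVars) :
    Relation.ReflTransGen Φ.gltGraph.Adj (Φ.outFrom i) (Φ.outFrom 0) := by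
  induction i with
  | zero => exact .refl
  | succ i ih =>
    have hout := ih (by omega)
    rw [outFrom_of_lt hi] at hout
    exact .head (outFrom_succ_adj_wit ⟨i, hi⟩) (.head (wit_adj_out _) hout)

theorem out_reaches (i : Fin Φ.numVars) :
    Relation.ReflTransGen Φ.gltGraph.Adj (.out i) (Φ.outFrom 0) :=
  outFrom_of_lt i.2 ▸ outFrom_reaches i.val i.2.le

theorem wit_reaches (i : Fin Φ.numVars) :
    Relation.ReflTransGen Φ.gltGraph.Adj (.wit i) (Φ.outFrom 0) :=
  .head (wit_adj_out i) (out_reaches i)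

theorem bar_reaches (h : Φ.quant i = .ex) :
    Relation.ReflTransGen Φ.gltGraph.Adj (.bar i h) (Φ.outFrom 0) :=
  .head ((adj_out_ex_iff h).mpr (.inr rfl)) (out_reaches i)

theorem lit_reaches (i : Fin Φ.numVars) (b : Bool) :
    Relation.ReflTransGen Φ.gltGraph.Adj (.lit i b) (Φ.outFrom 0) := by
  rcases b with _ | _
  · rcases hq : Φ.quant i with _ | _
    · exact .head ((adj_out_all_iff hq).mpr (.inr (.inr (.inr rfl)))) (out_reaches i)
    · exact .head ((adj_wit_ex_iff hq).mpr (.inr (.inr (.inr rfl)))) (wit_reaches i)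
  · exact .head (lit_true_adj_wit i) (wit_reaches i)

theorem apex_reaches (i : Fin Φ.numVars) (r : Fin 3) :
    Relation.ReflTransGen Φ.gltGraph.Adj (Φ.apex i r) (Φ.outFrom 0) := by
  match r, hq : Φ.quant i with
  | 0, .all => exact .head ((adj_wit_all_iff hq).mpr (.inr (.inr (.inr rfl)))) (wit_reaches i)
  | 0, .ex => exact .head (adj_lit_iff.mpr (belowLit_ex_true hq).symm) (lit_reaches i true)
  | 1, _ => exact .head (apex_one_adj_wit i) (wit_reaches i)
  | 2, .all => exact .head (adj_lit_iff.mpr (belowLit_all_true hq).symm) (lit_reaches i true)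
  | 2, .ex => exact .head (adj_bar_iff.mpr (.inr rfl)) (bar_reaches hq)

theorem chk_reaches (j : Fin (Φ.numClauses + 1)) :
    Relation.ReflTransGen Φ.gltGraph.Adj (.chk j) (Φ.outFrom 0) := by
  induction j using Fin.reverseInduction with
  | last => exact outFrom_of_le (Φ := Φ) le_rfl ▸ outFrom_reaches _ le_rfl
  | cast c ih => exact .head (adj_chk_succ_iff.mpr (.inl rfl)) ih

theorem reaches_outFrom_zero (v : Φ.Vertex) :
    Relation.ReflTransGen Φ.gltGraph.Adj v (Φ.outFrom 0) := by
  rcases v with ⟨i, r, v⟩ | ⟨i, b⟩ | ⟨i, hi⟩ | i | i | j | ⟨j, k⟩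
  · exact (pyr_reaches_apex _ _ v.1.1.2 v.1.2.2 v.2).trans (apex_reaches i r)
  · exact lit_reaches i b
  · exact bar_reaches hi
  · exact wit_reaches i
  · exact out_reaches i
  · exact chk_reaches j
  · exact .head (adj_chk_succ_iff.mpr (.inr (.inr ⟨k, rfl⟩))) (chk_reaches j.succ)

end QCNF

section AttachDiamond

variable {V : Type*} {G : Digraph V} {q : V} {k : ℕ}

/-- The vertex with the given coordinates in the diamond on top of `q`. The value outside the
diamond does not matter. -/
def diamondVertex (q : V) (k a b : ℕ) : V ⊕ DiamondInner k :=
  if h : (a < k ∧ b < k) ∧ ¬ (a = 0 ∧ b = 0) then .inr ⟨(⟨a, h.1.1⟩, ⟨b, h.1.2⟩), h.2⟩ else .inl q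

theorem diamondVertex_zero : diamondVertex q k 0 0 = .inl q :=
  dif_neg fun h => h.2 ⟨rfl, rfl⟩

theorem inl_eq_diamondVertex_iff {a b : ℕ} (ha : a < k) (hb : b < k) {u : V} :
    .inl u = diamondVertex q k a b ↔ u = q ∧ a = 0 ∧ b = 0 := by
  unfold diamondVertex
  split_ifs with h
  · simp only [false_iff]
    exact fun h' => h.2 h'.2
  · rw [Sum.inl.injEq]
    exact (and_iff_left (by omega)).symm

theorem inr_eq_diamondVertex_iff {a b : ℕ} {v : DiamondInner k} (ha : a < k) (hb : b < k) :
    .inr v = diamondVertex q k a b ↔ v.1.1.val = a ∧ v.1.2.val = b := by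
  unfold diamondVertex
  split_ifs with h
  · simp only [Sum.inr.injEq, Subtype.ext_iff, Prod.ext_iff, Fin.ext_iff]
  · simp only [false_iff]
    rintro ⟨rfl, rfl⟩
    exact h ⟨⟨ha, hb⟩, v.2⟩

theorem diamondVertex_injective {a b a' b' : ℕ} (ha : a < k) (hb : b < k) (ha' : a' < k)
    (hb' : b' < k) (h : diamondVertex q k a b = diamondVertex q k a' b') : a = a' ∧ b = b' := by
  rcases hv : diamondVertex q k a b with u | v
  · have := (inl_eq_diamondVertex_iff ha hb).mp hv.symm
    have := (inl_eq_diamondVertex_iff ha' hb').mp (hv.symm.trans h)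
    omega
  · have := (inr_eq_diamondVertex_iff ha hb).mp hv.symm
    have := (inr_eq_diamondVertex_iff ha' hb').mp (hv.symm.trans h)
    omega

theorem diamondVertex_of_pos {a b : ℕ} (ha : a < k) (hb : b < k) (h : ¬ (a = 0 ∧ b = 0)) :
    diamondVertex q k a b = .inr ⟨(⟨a, ha⟩, ⟨b, hb⟩), h⟩ :=
  dif_pos ⟨⟨ha, hb⟩, h⟩

theorem attachDiamond_adj_diamondVertex_iff {a b : ℕ} (ha : a < k) (hb : b < k)
    (h : ¬ (a = 0 ∧ b = 0)) {u : V ⊕ DiamondInner k} :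
    (attachDiamond G q k).Adj u (diamondVertex q k a b) ↔
      (∃ a', a = a' + 1 ∧ u = diamondVertex q k a' b) ∨
      (∃ b', b = b' + 1 ∧ u = diamondVertex q k a b') := by
  rw [diamondVertex_of_pos ha hb h]
  rcases u with u | ⟨⟨⟨x, hx⟩, ⟨y, hy⟩⟩, hxy⟩
  · constructor
    · rintro ⟨rfl, o, h₁, h₂, ⟨hoa, hob⟩ | ⟨hoa, hob⟩⟩
      · have hoa : o.1.val + 1 = a := hoa
        have hob : o.2.val = b := congrArg Fin.val hob
        exact .inl ⟨0, by omega, (inl_eq_diamondVertex_iff (by omega) hb).mpr ⟨rfl, rfl, by omega⟩⟩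
      · have hoa : o.1.val = a := congrArg Fin.val hoa
        have hob : o.2.val + 1 = b := hob
        exact .inr ⟨0, by omega, (inl_eq_diamondVertex_iff ha (by omega)).mpr ⟨rfl, by omega, rfl⟩⟩
    · rintro (⟨a', rfl, h'⟩ | ⟨b', rfl, h'⟩)
      · obtain ⟨rfl, rfl, rfl⟩ := (inl_eq_diamondVertex_iff (by omega) hb).mp h'
        exact ⟨rfl, (⟨0, by omega⟩, ⟨0, hb⟩), rfl, rfl, .inl ⟨rfl, rfl⟩⟩
      · obtain ⟨rfl, rfl, rfl⟩ := (inl_eq_diamondVertex_iff ha (by omega)).mp h'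
        exact ⟨rfl, (⟨0, ha⟩, ⟨0, by omega⟩), rfl, rfl, .inr ⟨rfl, rfl⟩⟩
  · constructor
    · rintro (⟨hoa, hob⟩ | ⟨hoa, hob⟩)
      · exact .inl ⟨x, hoa.symm, (inr_eq_diamondVertex_iff hx hb).mpr ⟨rfl, congrArg Fin.val hob⟩⟩
      · exact .inr ⟨y, hob.symm, (inr_eq_diamondVertex_iff ha hy).mpr ⟨congrArg Fin.val hoa, rfl⟩⟩
    · rintro (⟨a', rfl, h'⟩ | ⟨b', rfl, h'⟩)
      · obtain ⟨rfl, rfl⟩ := (inr_eq_diamondVertex_iff (by omega) hb).mp h'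
        exact .inl ⟨rfl, rfl⟩
      · obtain ⟨rfl, rfl⟩ := (inr_eq_diamondVertex_iff ha (by omega)).mp h'
        exact .inr ⟨rfl, rfl⟩

theorem adj_diamondVertex_left {a b : ℕ} (ha : a + 1 < k) (hb : b < k) :
    (attachDiamond G q k).Adj (diamondVertex q k a b) (diamondVertex q k (a + 1) b) :=
  (attachDiamond_adj_diamondVertex_iff ha hb (by omega)).mpr (.inl ⟨a, rfl, rfl⟩)

theorem adj_diamondVertex_right {a b : ℕ} (ha : a < k) (hb : b + 1 < k) :
    (attachDiamond G q k).Adj (diamondVertex q k a b) (diamondVertex q k a (b + 1)) :=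
  (attachDiamond_adj_diamondVertex_iff ha hb (by omega)).mpr (.inr ⟨b, rfl, rfl⟩)

theorem diamondVertex_reaches {a b c d : ℕ} (hac : a ≤ c) (hbd : b ≤ d) (hc : c < k)
    (hd : d < k) :
    Relation.ReflTransGen (attachDiamond G q k).Adj (diamondVertex q k a b)
      (diamondVertex q k c d) := by
  let R := (attachDiamond G q k).Adj
  have hleft : Relation.ReflTransGen R (diamondVertex q k a b) (diamondVertex q k c b) :=
    (reflTransGen_of_succ_of_le (fun i j => R (diamondVertex q k i b) (diamondVertex q k j b))
      (fun _ hi => adj_diamondVertex_left (Nat.lt_of_le_of_lt hi.2 hc)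
        (Nat.lt_of_le_of_lt hbd hd)) hac).lift _ fun _ _ h => h
  have hright : Relation.ReflTransGen R (diamondVertex q k c b) (diamondVertex q k c d) :=
    (reflTransGen_of_succ_of_le (fun i j => R (diamondVertex q k c i) (diamondVertex q k c j))
      (fun _ hi => adj_diamondVertex_right hc (Nat.lt_of_le_of_lt hi.2 hd)) hbd).lift _
      fun _ _ h => h
  exact hleft.trans hright

theorem attachDiamond_reaches (hk : 0 < k) (hG : ∀ v, Relation.ReflTransGen G.Adj v q)
    (v : V ⊕ DiamondInner k) : Relation.ReflTransGen (attachDiamond G q k).Adj v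
      (diamondVertex q k (k - 1) (k - 1)) := by
  rcases v with v | v
  · have hv : Relation.ReflTransGen (attachDiamond G q k).Adj (.inl v) (.inl q) :=
      (hG v).lift Sum.inl fun _ _ h => h
    have hq := diamondVertex_reaches (G := G) (q := q) (Nat.zero_le (k - 1)) (Nat.zero_le (k - 1))
      (Nat.sub_one_lt_of_lt hk) (Nat.sub_one_lt_of_lt hk)
    rw [diamondVertex_zero] at hq
    exact hv.trans hq
  · obtain ⟨⟨⟨a, ha⟩, ⟨b, hb⟩⟩, hab⟩ := v
    rw [← diamondVertex_of_pos (q := q) ha hb hab]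
    exact diamondVertex_reaches (Nat.le_sub_one_of_lt ha) (Nat.le_sub_one_of_lt hb)
      (Nat.sub_one_lt_of_lt hk) (Nat.sub_one_lt_of_lt hk)

theorem isRoot_attachDiamond_iff (hk : 2 ≤ k) (hG : ∀ v, Relation.ReflTransGen G.Adj v q)
    (v : V ⊕ DiamondInner k) :
    (attachDiamond G q k).IsRoot v ↔ v = diamondVertex q k (k - 1) (k - 1) := by
  constructor
  · intro h
    rcases (attachDiamond_reaches (by omega) hG v).cases_head with h' | ⟨w, hw, -⟩
    · exact h'
    · exact absurd hw (h w)
  · rintro rfl w hw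
    rw [diamondVertex_of_pos (by omega) (by omega) (by omega)] at hw
    rcases w with w | ⟨⟨⟨x, hx⟩, ⟨y, hy⟩⟩, hxy⟩
    · exact hw
    · rcases hw with ⟨hoa, -⟩ | ⟨-, hob⟩
      · have hoa : k - 1 + 1 = x := hoa
        omega
      · have hob : k - 1 + 1 = y := hob
        omega

theorem exists_inl_of_transGen_attachDiamond {u : V ⊕ DiamondInner k} {v : V}
    (h : Relation.TransGen (attachDiamond G q k).Adj u (.inl v)) :
    ∃ u', u = .inl u' ∧ Relation.TransGen G.Adj u' v := by
  induction h using Relation.TransGen.head_induction_on with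
  | @single u h =>
    rcases u with u | u
    · exact ⟨u, rfl, .single h⟩
    · exact h.elim
  | @head u w h _ ih =>
    obtain ⟨w, rfl, hw⟩ := ih
    rcases u with u | u
    · exact ⟨u, rfl, .head h hw⟩
    · exact h.elim

theorem exists_inr_of_transGen_attachDiamond {u : DiamondInner k} {w : V ⊕ DiamondInner k}
    (h : Relation.TransGen (attachDiamond G q k).Adj (.inr u) w) :
    ∃ v : DiamondInner k, w = .inr v ∧ u.1.1.val + u.1.2.val < v.1.1.val + v.1.2.val := by
  have hadj {u v : DiamondInner k} (h : (attachDiamond G q k).Adj (.inr u) (.inr v)) :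
      u.1.1.val + u.1.2.val < v.1.1.val + v.1.2.val := by
    rcases h with ⟨ha, hb⟩ | ⟨ha, hb⟩ <;> omega
  induction h with
  | @single w h =>
    rcases w with w | w
    · exact h.elim
    · exact ⟨w, rfl, hadj h⟩
  | @tail w w' _ h ih =>
    obtain ⟨w, rfl, hw⟩ := ih
    rcases w' with w' | w'
    · exact h.elim
    · exact ⟨w', rfl, hw.trans (hadj h)⟩

theorem isAcyclic_attachDiamond (hG : G.IsAcyclic) : (attachDiamond G q k).IsAcyclic := by
  rintro (v | v) hv
  · obtain ⟨_, h, hv'⟩ := exists_inl_of_transGen_attachDiamond hv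
    obtain rfl := Sum.inl_injective h
    exact hG _ hv'
  · obtain ⟨_, h, hlt⟩ := exists_inr_of_transGen_attachDiamond hv
    obtain rfl := Sum.inr_injective h
    exact lt_irrefl _ hlt

end AttachDiamond

/-! ### The number of vertices -/

namespace QCNF

variable (Φ : QCNF)

theorem pyramidSize_le (i : Fin Φ.numVars) (r : Fin 3) :
    Φ.pyramidSize i r ≤ 3 * Φ.numVars + 3 := by
  unfold pyramidSize
  omega

/-- A product type for each kind of vertex, large enough for `QCNF.vertexCode`; it serves to count
the vertices. -/
abbrev VertexCode : Type :=
  (Fin Φ.numVars × Fin 3 × Fin (3 * Φ.numVars + 3) × Fin (3 * Φ.numVars + 3)) ⊕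
  (Fin Φ.numVars × Bool) ⊕ Fin Φ.numVars ⊕ Fin Φ.numVars ⊕ Fin Φ.numVars ⊕
  Fin (Φ.numClauses + 1) ⊕ (Fin Φ.numClauses × Fin 3)

/-- The code of a vertex: its arguments, with the dependent bounds weakened to uniform ones. -/
def vertexCode : Φ.Vertex → Φ.VertexCode
  | .pyr i r v => .inl (i, r, v.1.1.castLE (Φ.pyramidSize_le i r),
      v.1.2.castLE (Φ.pyramidSize_le i r))
  | .lit i b => .inr (.inl (i, b))
  | .bar i _ => .inr (.inr (.inl i))
  | .wit i => .inr (.inr (.inr (.inl i)))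
  | .out i => .inr (.inr (.inr (.inr (.inl i))))
  | .chk j => .inr (.inr (.inr (.inr (.inr (.inl j)))))
  | .pad j k => .inr (.inr (.inr (.inr (.inr (.inr (j, k.castLE (Nat.sub_le _ _)))))))

theorem vertexCode_injective : Function.Injective Φ.vertexCode := by
  rintro (⟨i, r, v⟩ | ⟨i, b⟩ | ⟨i, hi⟩ | i | i | j | ⟨j, k⟩)
    (⟨i', r', v'⟩ | ⟨i', b'⟩ | ⟨i', hi'⟩ | i' | i' | j' | ⟨j', k'⟩) h <;>
    simp only [vertexCode, reduceCtorEq, Sum.inl.injEq, Sum.inr.injEq, Prod.mk.injEq] at h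
  · obtain ⟨rfl, rfl, ha, hb⟩ := h
    exact congrArg _ <| Subtype.ext <|
      Prod.ext (Fin.castLE_injective _ ha) (Fin.castLE_injective _ hb)
  · obtain ⟨rfl, rfl⟩ := h
    rfl
  · subst h
    rfl
  · subst h
    rfl
  · subst h
    rfl
  · subst h
    rfl
  · obtain ⟨rfl, h⟩ := h
    rw [Fin.castLE_injective _ h]

instance : Finite Φ.Vertex := .of_injective _ Φ.vertexCode_injective

theorem card_vertex_le : Nat.card Φ.Vertex ≤ 36 * Φ.size ^ 3 := by
  refine (Nat.card_le_card_of_injective _ Φ.vertexCode_injective).trans ?_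
  simp only [Nat.card_eq_fintype_card, Fintype.card_sum, Fintype.card_prod, Fintype.card_fin,
    Fintype.card_bool]
  have hn : Φ.numVars + 1 ≤ Φ.size := by unfold size; omega
  have hm : Φ.numClauses + 1 ≤ Φ.size := by unfold size; omega
  have hpyr : Φ.numVars * (3 * ((3 * Φ.numVars + 3) * (3 * Φ.numVars + 3))) ≤ 27 * Φ.size ^ 3 :=
    calc _ = 27 * (Φ.numVars * (Φ.numVars + 1) ^ 2) := by ring
      _ ≤ 27 * (Φ.size * Φ.size ^ 2) := by gcongr; omega
      _ = 27 * Φ.size ^ 3 := by ring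
  have hlin : Φ.size ≤ Φ.size ^ 3 := Nat.le_self_pow three_ne_zero _
  omega

theorem card_spookyVertex_le : Nat.card Φ.SpookyVertex ≤ 52 * Φ.size ^ 3 := by
  have hdiamond : Nat.card (DiamondInner (3 * Φ.numVars + 4)) ≤ 16 * Φ.size ^ 3 :=
    calc _ ≤ Nat.card (Fin (3 * Φ.numVars + 4) × Fin (3 * Φ.numVars + 4)) :=
          Nat.card_le_card_of_injective _ Subtype.val_injective
      _ = (3 * Φ.numVars + 4) ^ 2 := by rw [Nat.card_prod, Nat.card_fin, sq]
      _ ≤ (4 * Φ.size) ^ 2 := Nat.pow_le_pow_left (by unfold size; omega) 2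
      _ = 16 * Φ.size ^ 2 := by ring
      _ ≤ 16 * Φ.size ^ 3 := by
          gcongr
          · exact Nat.succ_pos _
          · norm_num
  rw [SpookyVertex, Nat.card_sum]
  linarith [Φ.card_vertex_le]

end QCNF

/-! ### Counting the pebbles of a block -/

/-- The parts of the block of a variable: three pyramids, two literals, the vertex `bar` below the
negative literal of an existential variable, the witness and the output. All vertices of the
clauses form one more part. -/
inductive BlockPart
  | pyr (r : Fin 3)
  | lit (b : Bool)
  | bar
  | wit
  | out
  | clause
  deriving DecidableEq

namespace QCNF

variable {Φ : QCNF}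

/-- The block to which a vertex belongs; the clauses form the last block. -/
def block : Φ.Vertex → ℕ
  | .pyr i _ _ => i
  | .lit i _ => i
  | .bar i _ => i
  | .wit i => i
  | .out i => i
  | .chk _ => Φ.numVars
  | .pad _ _ => Φ.numVars

/-- The part of its block to which a vertex belongs. -/
def part : Φ.Vertex → BlockPart
  | .pyr _ r _ => .pyr r
  | .lit _ b => .lit b
  | .bar _ _ => .bar
  | .wit _ => .wit
  | .out _ => .out
  | .chk _ => .clause
  | .pad _ _ => .clause

/-- The number of pebbles on a part of a block. -/
def partCount (Q : Finset Φ.Vertex) (i : ℕ) (l : BlockPart) : ℕ :=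
  (Q.filter fun v => block v = i ∧ part v = l).card

/-- The number of pebbles on a block. -/
def blockCount (Q : Finset Φ.Vertex) (i : ℕ) : ℕ := (Q.filter fun v => block v = i).card

/-- The number of pebbles on the blocks from `i` on. -/
def countFrom (Q : Finset Φ.Vertex) (i : ℕ) : ℕ := (Q.filter fun v => i ≤ block v).card

section Count

variable {Q Q' : Finset Φ.Vertex} {v : Φ.Vertex} {i : ℕ}

theorem partCount_pos (hv : v ∈ Q) : 0 < partCount Q (block v) (part v) :=
  Finset.card_pos.mpr ⟨v, Finset.mem_filter.mpr ⟨hv, rfl, rfl⟩⟩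

theorem notMem_of_partCount_eq_zero (h : partCount Q (block v) (part v) = 0) : v ∉ Q :=
  fun hv => (partCount_pos hv).ne' h

theorem partCount_mono (h : Q ⊆ Q') (i : ℕ) (l : BlockPart) : partCount Q i l ≤ partCount Q' i l :=
  Finset.card_le_card (Finset.filter_subset_filter _ h)

theorem partCount_eq_zero_of_block_lt (h : ∀ v ∈ Q, block v < i) (l : BlockPart) :
    partCount Q i l = 0 :=
  Finset.card_eq_zero.mpr <| Finset.filter_eq_empty_iff.mpr fun v hv h' => (h v hv).ne h'.1

theorem sum_partCount_le (Q : Finset Φ.Vertex) (i : ℕ) (s : Finset BlockPart) :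
    ∑ l ∈ s, partCount Q i l ≤ blockCount Q i := by
  calc ∑ l ∈ s, partCount Q i l
      = ∑ l ∈ s, ((Q.filter fun v => block v = i).filter fun v => part v = l).card := by
        simp only [Finset.filter_filter, partCount]
    _ ≤ _ := by
        rw [Finset.sum_card_fiberwise_eq_card_filter]
        exact Finset.card_filter_le _ _

theorem add_partCount_le (Q : Finset Φ.Vertex) (i : ℕ) :
    partCount Q i (.pyr 0) + partCount Q i (.pyr 1) + partCount Q i (.pyr 2) +
      partCount Q i (.lit true) + partCount Q i (.lit false) + partCount Q i .bar +
      partCount Q i .wit ≤ blockCount Q i := by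
  have h := sum_partCount_le Q i {.pyr 0, .pyr 1, .pyr 2, .lit true, .lit false, .bar, .wit}
  simp only [Finset.sum_insert, Finset.sum_singleton, Finset.mem_insert, Finset.mem_singleton,
    reduceCtorEq, BlockPart.pyr.injEq, BlockPart.lit.injEq, Fin.reduceEq, or_self,
    not_false_eq_true, Bool.true_eq_false] at h
  omega

theorem countFrom_eq (Q : Finset Φ.Vertex) (i : ℕ) :
    countFrom Q i = blockCount Q i + countFrom Q (i + 1) := by
  unfold countFrom blockCount
  rw [← Finset.card_union_of_disjoint (Finset.disjoint_filter.mpr fun _ _ h => by omega),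
    ← Finset.filter_or]
  exact congrArg Finset.card (Finset.filter_congr fun _ _ => by omega)

theorem block_lt_of_countFrom_eq_zero (h : countFrom Q i = 0) : ∀ v ∈ Q, block v < i := by
  rw [countFrom, Finset.card_eq_zero, Finset.filter_eq_empty_iff] at h
  exact fun v hv => not_le.mp (h hv)

theorem sum_blockCount_add_countFrom (Q : Finset Φ.Vertex) (i : ℕ) :
    (∑ j ∈ Finset.range i, blockCount Q j) + countFrom Q i = Q.card := by
  induction i with
  | zero => simp [countFrom]
  | succ i ih => rw [Finset.sum_range_succ, add_assoc, ← countFrom_eq, ih]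

end Count

/-! ### Closing a pyramid -/

section Pyramid

variable {i : Fin Φ.numVars} {r : Fin 3} {a b : ℕ} {Q : Finset Φ.Vertex} {L : Finset BlockPart}
  {P : ℕ → Finset Φ.Vertex} {t₀ t₁ : ℕ}

/-- The vertices of a pyramid as a triangular grid. The value outside the pyramid does not
matter. -/
def pyrGrid (i : Fin Φ.numVars) (r : Fin 3) (a b : ℕ) : Φ.Vertex :=
  if h : a + b < Φ.pyramidSize i r then .pyr i r ⟨(⟨a, by omega⟩, ⟨b, by omega⟩), h⟩
  else Φ.apex i r

theorem pyrGrid_zero (i : Fin Φ.numVars) (r : Fin 3) : pyrGrid i r 0 0 = Φ.apex i r := by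
  unfold pyrGrid
  split_ifs <;> rfl

theorem pyrGrid_injective {a' b' : ℕ} (h : a + b < Φ.pyramidSize i r)
    (h' : a' + b' < Φ.pyramidSize i r) (he : pyrGrid i r a b = pyrGrid i r a' b') :
    a = a' ∧ b = b' := by
  rw [pyrGrid, dif_pos h, pyrGrid, dif_pos h'] at he
  simpa using he

theorem block_pyrGrid : block (pyrGrid i r a b) = i := by
  unfold pyrGrid
  split_ifs <;> rfl

theorem part_pyrGrid : part (pyrGrid i r a b) = .pyr r := by
  unfold pyrGrid
  split_ifs <;> rfl

theorem pyrGrid_adj_left (h : a + b + 1 < Φ.pyramidSize i r) :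
    Φ.gltGraph.Adj (pyrGrid i r (a + 1) b) (pyrGrid i r a b) := by
  rw [pyrGrid, dif_pos (by omega), pyrGrid, dif_pos (by omega)]
  exact adj_pyr_iff.mpr ⟨⟨(⟨a + 1, by omega⟩, ⟨b, by omega⟩), by simp only; omega⟩,
    .inl ⟨rfl, rfl⟩, rfl⟩

theorem pyrGrid_adj_right (h : a + b + 1 < Φ.pyramidSize i r) :
    Φ.gltGraph.Adj (pyrGrid i r a (b + 1)) (pyrGrid i r a b) := by
  rw [pyrGrid, dif_pos (by omega), pyrGrid, dif_pos (by omega)]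
  exact adj_pyr_iff.mpr ⟨⟨(⟨a, by omega⟩, ⟨b + 1, by omega⟩), by simp only; omega⟩,
    .inr ⟨rfl, rfl⟩, rfl⟩

theorem isGrid_pyrGrid (i : Fin Φ.numVars) (r : Fin 3) :
    IsGrid Φ.gltGraph (pyrGrid i r) (Φ.pyramidSize i r - 1) where
  inj _ _ _ _ h h' he := pyrGrid_injective (by omega) (by omega) he
  adj_left _ _ _ := pyrGrid_adj_left (by omega)
  adj_right _ _ _ := pyrGrid_adj_right (by omega)

theorem four_le_pyramidSize (i : Fin Φ.numVars) (r : Fin 3) : 4 ≤ Φ.pyramidSize i r := by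
  unfold pyramidSize
  omega

/-- The apex of a pyramid, and the vertices of its block in the parts `L`, which are meant to lie
on top of it. -/
def pyrCap (i : Fin Φ.numVars) (r : Fin 3) (L : Finset BlockPart) : Set Φ.Vertex :=
  insert (Φ.apex i r) {v | block v = i ∧ part v ∈ L}

/-- Some path from the last row but one of a pyramid to the row below the apex is free of pebbles,
and so are the apex and the parts `L` on top of the pyramid. -/
def PyrOpen (i : Fin Φ.numVars) (r : Fin 3) (L : Finset BlockPart) (Q : Finset Φ.Vertex) : Prop :=
  GridOpen (pyrGrid i r) (Φ.pyramidSize i r - 1) (pyrCap i r L) Q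

/-- The parts `L` of the block of `xᵢ` can be pebbled only after the apex of the `r`-th pyramid. -/
def IsBuiltOn (i : Fin Φ.numVars) (r : Fin 3) (L : Finset BlockPart) : Prop :=
  ∀ v : Φ.Vertex, block v = i → part v ∈ L → ∃ u ∈ pyrCap i r L, Φ.gltGraph.Adj u v

theorem isBuiltOn_empty : IsBuiltOn i r ∅ := fun _ _ h => absurd h (Finset.notMem_empty _)

theorem isBuiltOn_lit {b : Bool} (h : Φ.belowLit i b = Φ.apex i r) : IsBuiltOn i r {.lit b} := by
  intro v hi hl
  rcases v with _ | ⟨j, b'⟩ | _ | _ | _ | _ | _ <;> simp only [part, Finset.mem_singleton,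
    reduceCtorEq, BlockPart.lit.injEq] at hl
  obtain rfl : j = i := Fin.ext hi
  subst hl
  exact ⟨_, .inl rfl, adj_lit_iff.mpr h.symm⟩

theorem isBuiltOn_bar_lit_false (h : Φ.quant i = .ex) : IsBuiltOn i 2 {.bar, .lit false} := by
  intro v hi hl
  rcases v with _ | ⟨j, b⟩ | ⟨j, hj⟩ | _ | _ | _ | _ <;> simp only [part, Finset.mem_insert,
    Finset.mem_singleton, reduceCtorEq, BlockPart.lit.injEq, or_false, false_or] at hl
  · obtain rfl : j = i := Fin.ext hi
    subst hl
    exact ⟨.bar j h, .inr ⟨rfl, by simp [part]⟩, adj_lit_iff.mpr (belowLit_ex_false h).symm⟩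
  · obtain rfl : j = i := Fin.ext hi
    exact ⟨_, .inl rfl, adj_bar_iff.mpr (.inr rfl)⟩

theorem IsBuiltOn.isGridCap (hL : IsBuiltOn i r L) :
    IsGridCap Φ.gltGraph (pyrGrid i r) (pyrCap i r L) := by
  have hs := four_le_pyramidSize i r
  rintro v (rfl | ⟨hi, hl⟩)
  · rw [← pyrGrid_zero]
    exact .inr ⟨pyrGrid_adj_right (by omega), pyrGrid_adj_left (by omega)⟩
  · exact .inl (hL v hi hl)

theorem PyrOpen.of_partCount (h : partCount Q i (.pyr r) = 0)
    (hL : ∀ l ∈ L, partCount Q i l = 0) : PyrOpen i r L Q := by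
  refine .of_forall_notMem (fun a b _ _ => notMem_of_partCount_eq_zero ?_) ?_
  · rwa [block_pyrGrid, part_pyrGrid]
  · rintro v (rfl | ⟨hi, hl⟩)
    · exact notMem_of_partCount_eq_zero h
    · exact notMem_of_partCount_eq_zero (hi ▸ hL _ hl)

theorem PyrOpen.of_empty (h : PyrOpen i r ∅ Q) (hL : ∀ l ∈ L, partCount Q i l = 0) :
    PyrOpen i r L Q := by
  refine ⟨h.1, ?_⟩
  rintro v (rfl | ⟨hi, hl⟩)
  · exact h.2 _ (.inl rfl)
  · exact notMem_of_partCount_eq_zero (hi ▸ hL _ hl)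

theorem not_pyrOpen_of_mem {v : Φ.Vertex} (hv : v ∈ pyrCap i r L) (h : v ∈ Q) :
    ¬ PyrOpen i r L Q :=
  fun ho => ho.2 v hv h

theorem partCount_pos_of_not_pyrOpen (h : ¬ PyrOpen i r L Q) :
    0 < partCount Q i (.pyr r) + ∑ l ∈ L, partCount Q i l := by
  contrapose! h
  obtain ⟨hr, hL⟩ := Nat.add_eq_zero_iff.mp (Nat.le_zero.mp h)
  exact .of_partCount hr (Finset.sum_eq_zero_iff.mp hL)

/-- Besides the pebbles that close the grid there are the two predecessors of its source, which
belong to the last row of the pyramid. -/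
theorem pyramidSize_lt_partCount_of_isLastClosing {F : Set Φ.Vertex} {τ : ℕ}
    (h : IsLastClosing Φ.gltGraph (pyrGrid i r) (Φ.pyramidSize i r - 1) F P τ t₁) :
    Φ.pyramidSize i r < partCount (P (τ + 1)) i (.pyr r) := by
  obtain ⟨a, b, hab, -, hpred⟩ := h.exists_source
  let C := P (τ + 1) ∩ gridCells (pyrGrid i r) (Φ.pyramidSize i r - 1)
  let T : Finset Φ.Vertex := {pyrGrid i r (a + 1) b, pyrGrid i r a (b + 1)}
  have hTcard : T.card = 2 := by
    refine Finset.card_pair fun he => ?_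
    have := pyrGrid_injective (by omega) (by omega) he
    omega
  have hdisj : Disjoint C T := by
    refine Finset.disjoint_left.mpr fun v hC hT => ?_
    obtain ⟨x, y, -, hxy, rfl⟩ := mem_gridCells.mp (Finset.mem_inter.mp hC).2
    rcases Finset.mem_insert.mp hT with he | he
    · have := pyrGrid_injective (by omega) (by omega) he
      omega
    · have := pyrGrid_injective (by omega) (by omega) (Finset.mem_singleton.mp he)
      omega
  have hsub : C ∪ T ⊆ (P (τ + 1)).filter fun v => block v = i ∧ part v = .pyr r := by
    refine Finset.union_subset (fun v hv => ?_) (fun v hv => ?_)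
    · obtain ⟨hvP, hv⟩ := Finset.mem_inter.mp hv
      obtain ⟨x, y, -, -, rfl⟩ := mem_gridCells.mp hv
      exact Finset.mem_filter.mpr ⟨hvP, block_pyrGrid, part_pyrGrid⟩
    · rcases Finset.mem_insert.mp hv with rfl | hv
      · exact Finset.mem_filter.mpr
          ⟨h.subset (hpred _ (pyrGrid_adj_left (by omega))), block_pyrGrid, part_pyrGrid⟩
      · obtain rfl := Finset.mem_singleton.mp hv
        exact Finset.mem_filter.mpr
          ⟨h.subset (hpred _ (pyrGrid_adj_right (by omega))), block_pyrGrid, part_pyrGrid⟩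
  have hcard : (C ∪ T).card ≤ partCount (P (τ + 1)) i (.pyr r) := Finset.card_le_card hsub
  rw [Finset.card_union_of_disjoint hdisj, hTcard] at hcard
  have hC : Φ.pyramidSize i r - 1 ≤ C.card := h.card_le
  omega

theorem IsBuiltOn.exists_closing (hL : IsBuiltOn i r L)
    (hP : ∀ t, BlackMove Φ.gltGraph (P t) (P (t + 1))) (h : t₀ ≤ t₁)
    (ho : PyrOpen i r L (P t₀)) (hc : ¬ PyrOpen i r L (P t₁)) :
    ∃ τ, t₀ ≤ τ ∧ τ < t₁ ∧ PyrOpen i r L (P τ) ∧ P τ ⊆ P (τ + 1) ∧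
      Φ.pyramidSize i r < partCount (P (τ + 1)) i (.pyr r) ∧
      ∀ t, τ < t → t ≤ t₁ → ¬ PyrOpen i r L (P t) := by
  have hs := four_le_pyramidSize i r
  obtain ⟨τ, h₀, h₁, hτ⟩ :=
    (isGrid_pyrGrid i r).exists_isLastClosing hL.isGridCap (by omega) hP h ho hc
  exact ⟨τ, h₀, h₁, hτ.isOpen, hτ.subset, pyramidSize_lt_partCount_of_isLastClosing hτ, hτ.closed⟩

theorem exists_refill (hP : ∀ t, BlackMove Φ.gltGraph (P t) (P (t + 1))) (h : t₀ ≤ t₁)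
    (h₀ : partCount (P t₀) i (.pyr r) = 0) (h₁ : Φ.apex i r ∈ P t₁) :
    ∃ τ, t₀ ≤ τ ∧ τ < t₁ ∧ PyrOpen i r ∅ (P τ) ∧ P τ ⊆ P (τ + 1) ∧
      Φ.pyramidSize i r < partCount (P (τ + 1)) i (.pyr r) := by
  obtain ⟨τ, hτ₀, hτ₁, ho, hsub, hcard, -⟩ := isBuiltOn_empty.exists_closing hP h
    (.of_partCount h₀ (by simp)) (not_pyrOpen_of_mem (.inl rfl) h₁)
  exact ⟨τ, hτ₀, hτ₁, ho, hsub, hcard⟩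

end Pyramid

end QCNF

/-! ### Pebbling a block from scratch -/

namespace QCNF

variable {Φ : QCNF} {P : ℕ → Finset Φ.Vertex} {i : Fin Φ.numVars} {b : Bool}
  {t₀ tg t₂ s t u : ℕ} {L₀ L₂ : Finset BlockPart}

theorem pyramidSize_zero (i : Fin Φ.numVars) : Φ.pyramidSize i 0 = 3 * (Φ.numVars - i) + 3 := rfl

theorem pyramidSize_one (i : Fin Φ.numVars) : Φ.pyramidSize i 1 = 3 * (Φ.numVars - i) + 2 := rfl

theorem pyramidSize_two (i : Fin Φ.numVars) : Φ.pyramidSize i 2 = 3 * (Φ.numVars - i) + 1 := rfl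

/-- Somewhere in the interval `[t₀, t₁]` the rest of the graph is pebbled from scratch while the
block of `xᵢ` keeps three pebbles, and a fourth one if the literal of `xᵢ` that is false for the
value `b` is pebbled. -/
def HasPhase (P : ℕ → Finset Φ.Vertex) (i : Fin Φ.numVars) (b : Bool) (t₀ t₁ : ℕ) : Prop :=
  ∃ u₀ u₁, t₀ ≤ u₀ ∧ u₀ ≤ u₁ ∧ u₁ ≤ t₁ ∧ (∀ v ∈ P u₀, block v < i.val + 1) ∧
    Φ.outFrom (i.val + 1) ∈ P u₁ ∧ ∀ t, u₀ ≤ t → t ≤ u₁ →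
      3 + partCount (P t) i (.lit (!b)) ≤ blockCount (P t) i

/-- In the interval `[t₀, t₂]` the output of the block of `xᵢ` is made ready to be pebbled, where
the block is empty at first, the pebbles on it and on the rest of the graph stay within the budget,
and the witness is pebbled for the last time after `tg`. -/
structure IsBlockRun (P : ℕ → Finset Φ.Vertex) (i : Fin Φ.numVars) (t₀ tg t₂ : ℕ) : Prop where
  blackMove : ∀ t, BlackMove Φ.gltGraph (P t) (P (t + 1))
  block_lt : ∀ v ∈ P t₀, block v < i
  le : t₀ ≤ tg
  lt : tg < t₂
  mem_of_adj_wit : ∀ u, Φ.gltGraph.Adj u (.wit i) → u ∈ P tg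
  mem_of_adj_out : ∀ u, Φ.gltGraph.Adj u (.out i) → u ∈ P t₂
  wit_mem : ∀ t, tg < t → t ≤ t₂ → .wit i ∈ P t
  budget : ∀ t, t₀ ≤ t → t ≤ t₂ →
    blockCount (P t) i + countFrom (P t) (i + 1) ≤ 3 * (Φ.numVars - i) + 4

theorem exists_isBlockRun (hP : ∀ t, BlackMove Φ.gltGraph (P t) (P (t + 1))) {t₁ : ℕ}
    (h : t₀ ≤ t₁) (h₀ : ∀ v ∈ P t₀, block v < i) (h₁ : .out i ∈ P t₁)
    (hbudget : ∀ t, t₀ ≤ t → t ≤ t₁ →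
      blockCount (P t) i + countFrom (P t) (i + 1) ≤ 3 * (Φ.numVars - i) + 4) :
    ∃ tg t₂, t₂ ≤ t₁ ∧ IsBlockRun P i t₀ tg t₂ := by
  obtain ⟨t₂, hle₂, hlt₂, hout, -⟩ :=
    exists_last_placement hP h (fun hm => (h₀ _ hm).ne rfl) h₁
  obtain ⟨tg, hleg, hltg, hwit, hstay⟩ :=
    exists_last_placement hP hle₂ (fun hm => (h₀ _ hm).ne rfl) (hout _ (wit_adj_out i))
  exact ⟨tg, t₂, hlt₂.le, hP, h₀, hleg, hltg, hwit, hout, hstay,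
    fun t ht ht' => hbudget t ht (ht'.trans hlt₂.le)⟩

/-- From `s` to `tg` every pyramid of the block of `xᵢ` is guarded by a pebble, on the pyramid
itself or on the parts `L₀` or `L₂` built on it; at `s` the rest of the graph is empty. -/
structure IsGuarded (P : ℕ → Finset Φ.Vertex) (i : Fin Φ.numVars) (L₀ L₂ : Finset BlockPart)
    (s tg : ℕ) : Prop where
  le : s ≤ tg
  block_lt : ∀ v ∈ P s, block v < i.val + 1
  not_pyrOpen_zero : ∀ t, s ≤ t → t ≤ tg → ¬ PyrOpen i 0 L₀ (P t)
  pyr_one_pos : ∀ t, s ≤ t → t ≤ tg → 0 < partCount (P t) i (.pyr 1)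
  not_pyrOpen_two : ∀ t, s ≤ t → t ≤ tg → ¬ PyrOpen i 2 L₂ (P t)

theorem IsGuarded.hasPhase (hg : IsGuarded P i L₀ L₂ s tg) (h : IsBlockRun P i t₀ tg t₂)
    (hs : t₀ ≤ s)
    (hcount : ∀ t, s ≤ t → t ≤ tg → 3 + partCount (P t) i (.lit (!b)) ≤ blockCount (P t) i) :
    HasPhase P i b t₀ t₂ :=
  ⟨s, tg, hs, hg.le, h.lt.le, hg.block_lt, h.mem_of_adj_wit _ (outFrom_succ_adj_wit i), hcount⟩

/-- The pyramids are closed in the order of their sizes: when one of them is closed, the budget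
leaves no pebbles for the pyramids that follow. -/
theorem IsBlockRun.exists_isGuarded (h : IsBlockRun P i t₀ tg t₂) (hL₀ : IsBuiltOn i 0 L₀)
    (hL₂ : IsBuiltOn i 2 L₂) (hdisj : Disjoint (insert (.pyr 0) L₀) (insert (.pyr 2) L₂))
    (hpyr : .pyr 1 ∉ insert (.pyr 0) L₀ ∪ insert (.pyr 2) L₂) (hpyr₀ : .pyr 0 ∉ L₀)
    (hpyr₂ : .pyr 2 ∉ L₂) (hc₀ : ¬ PyrOpen i 0 L₀ (P tg)) (hc₂ : ¬ PyrOpen i 2 L₂ (P tg)) :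
    ∃ s, t₀ ≤ s ∧ IsGuarded P i L₀ L₂ s tg := by
  have hsum t : partCount (P t) i (.pyr 0) + ∑ l ∈ L₀, partCount (P t) i l +
      partCount (P t) i (.pyr 1) + (partCount (P t) i (.pyr 2) + ∑ l ∈ L₂, partCount (P t) i l) ≤
      blockCount (P t) i := by
    have hle := sum_partCount_le (P t) i
      (insert (.pyr 1) (insert (.pyr 0) L₀ ∪ insert (.pyr 2) L₂))
    rw [Finset.sum_insert hpyr, Finset.sum_union hdisj, Finset.sum_insert hpyr₀,
      Finset.sum_insert hpyr₂] at hle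
    omega
  have hsize₀ := pyramidSize_zero i
  have hsize₁ := pyramidSize_one i
  have hsize₂ := pyramidSize_two i
  have hlt := h.lt
  have hz := partCount_eq_zero_of_block_lt h.block_lt
  obtain ⟨τ₀, hle₀, hlt₀, -, -, hcard₀, hclosed₀⟩ := hL₀.exists_closing h.blackMove h.le
    (.of_partCount (hz _) fun l _ => hz l) hc₀
  have hsum₀ := hsum (τ₀ + 1)
  have hbudget₀ := h.budget (τ₀ + 1) (by omega) (by omega)
  obtain ⟨τ₁, hle₁, hlt₁, -, -, hcard₁, hclosed₁⟩ := (isBuiltOn_empty (r := 1)).exists_closing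
    h.blackMove (show τ₀ + 1 ≤ tg from hlt₀) (.of_partCount (by omega) (by simp))
    (not_pyrOpen_of_mem (.inl rfl) (h.mem_of_adj_wit _ (apex_one_adj_wit i)))
  have hsum₁ := hsum (τ₁ + 1)
  have hbudget₁ := h.budget (τ₁ + 1) (by omega) (by omega)
  have hguard₁ := partCount_pos_of_not_pyrOpen (hclosed₀ (τ₁ + 1) (by omega) (by omega))
  obtain ⟨τ₂, hle₂, hlt₂, -, -, hcard₂, hclosed₂⟩ := hL₂.exists_closing h.blackMove
    (show τ₁ + 1 ≤ tg from hlt₁)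
    (.of_partCount (by omega) (Finset.sum_eq_zero_iff.mp (by omega))) hc₂
  have hsum₂ := hsum (τ₂ + 1)
  have hbudget₂ := h.budget (τ₂ + 1) (by omega) (by omega)
  have hguard₂ := partCount_pos_of_not_pyrOpen (hclosed₀ (τ₂ + 1) (by omega) (by omega))
  have hpos₁ t (ht : τ₂ + 1 ≤ t) (ht' : t ≤ tg) : 0 < partCount (P t) i (.pyr 1) := by
    simpa using partCount_pos_of_not_pyrOpen (hclosed₁ t (by omega) ht')
  have := hpos₁ (τ₂ + 1) le_rfl hlt₂
  exact ⟨τ₂ + 1, by omega, hlt₂, block_lt_of_countFrom_eq_zero (by omega),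
    fun t ht => hclosed₀ t (by omega), hpos₁, fun t ht => hclosed₂ t (by omega)⟩

theorem IsBlockRun.wit_pos (h : IsBlockRun P i t₀ tg t₂) (ht : tg < t) (ht' : t ≤ t₂) :
    0 < partCount (P t) i .wit :=
  partCount_pos (h.wit_mem t ht ht')

theorem IsBlockRun.apex_zero_notMem (h : IsBlockRun P i t₀ tg t₂) (ht : t₀ ≤ t) (htu : t ≤ u)
    (hu : u ≤ t₂) (hz : partCount (P t) i (.pyr 0) = 0)
    (hguard : ∀ t', t ≤ t' → t' ≤ u → 0 < partCount (P t') i (.pyr 1) + partCount (P t') i .wit) :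
    Φ.apex i 0 ∉ P u := by
  intro hm
  obtain ⟨τ, hle, hlt, -, -, hcard⟩ := exists_refill h.blackMove htu hz hm
  have := h.budget (τ + 1) (by omega) (by omega)
  have := hguard (τ + 1) (by omega) hlt
  have := add_partCount_le (P (τ + 1)) i
  have := pyramidSize_zero i
  omega

section Existential

variable (h : IsBlockRun P i t₀ tg t₂) (hq : Φ.quant i = .ex)
  (hg : IsGuarded P i {.lit true} {.bar, .lit false} s tg) (hs : t₀ ≤ s)

include h hq hg hs

theorem IsBlockRun.bar_mem_of_pyr_zero (hst : s ≤ t) (htu : t ≤ u) (hu : u ≤ t₂)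
    (hz : partCount (P t) i (.pyr 0) = 0) : .bar i hq ∈ P u := by
  by_contra hm
  obtain ⟨τ, hle, hlt, hpred, -⟩ := exists_last_placement h.blackMove hu hm
    (h.mem_of_adj_out _ ((adj_out_ex_iff hq).mpr (.inr rfl)))
  refine h.apex_zero_notMem (hs.trans hst) (htu.trans hle) hlt.le hz (fun t' ht ht' => ?_)
    (hpred _ (adj_bar_iff.mpr (.inl rfl)))
  rcases le_or_gt t' tg with htg | htg
  · exact Nat.add_pos_left (hg.pyr_one_pos t' (hst.trans ht) htg) _
  · exact Nat.add_pos_right _ (h.wit_pos htg (ht'.trans hlt.le))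

/-- Refilling the third pyramid leaves no pebble for `bar` and the negative literal, so that the
pyramid would have been open together with them. -/
theorem IsBlockRun.bar_notMem_of_pyr_two (hst : s ≤ t) (htu : t ≤ u) (hu : u ≤ tg)
    (hz : partCount (P t) i (.pyr 2) = 0) (hbar : .bar i hq ∉ P t) : .bar i hq ∉ P u := by
  intro hm
  obtain ⟨t', hle', hlt', hpred, -⟩ := exists_last_placement h.blackMove htu hbar hm
  obtain ⟨τ, hle, hlt, hopen, hsub, hcard⟩ := exists_refill h.blackMove hle' hz
    (hpred _ (adj_bar_iff.mpr (.inr rfl)))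
  have := h.lt
  have hbudget := h.budget (τ + 1) (by omega) (by omega)
  have hguard₀ := partCount_pos_of_not_pyrOpen (hg.not_pyrOpen_zero (τ + 1) (by omega) (by omega))
  have hguard₁ := hg.pyr_one_pos (τ + 1) (by omega) (by omega)
  have hsum := add_partCount_le (P (τ + 1)) i
  have hsize := pyramidSize_two i
  rw [Finset.sum_singleton] at hguard₀
  refine hg.not_pyrOpen_two τ (by omega) (by omega) (hopen.of_empty fun l hl => ?_)
  refine Nat.le_zero.mp ((partCount_mono hsub i l).trans ?_)
  rcases Finset.mem_insert.mp hl with rfl | hl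
  · omega
  · obtain rfl := Finset.mem_singleton.mp hl
    omega

/-- If the pebbles do not suffice for the value `false`, then the first pyramid is empty at some
time, and `bar` has to be kept from then on. -/
theorem IsBlockRun.hasPhase_or : HasPhase P i true t₀ t₂ ∨ HasPhase P i false t₀ t₂ := by
  have hguard₀ t (ht : s ≤ t) (ht' : t ≤ tg) :
      0 < partCount (P t) i (.pyr 0) + partCount (P t) i (.lit true) := by
    simpa using partCount_pos_of_not_pyrOpen (hg.not_pyrOpen_zero t ht ht')
  have hguard₂ t (ht : s ≤ t) (ht' : t ≤ tg) : 0 < partCount (P t) i (.pyr 2) +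
      (partCount (P t) i .bar + partCount (P t) i (.lit false)) := by
    simpa using partCount_pos_of_not_pyrOpen (hg.not_pyrOpen_two t ht ht')
  by_cases hcase : ∀ t, s ≤ t → t ≤ tg →
      3 + partCount (P t) i (.lit true) ≤ blockCount (P t) i
  · exact .inr (hg.hasPhase h hs hcase)
  push Not at hcase
  obtain ⟨tx, hsx, hxg, hx⟩ := hcase
  have hsum := add_partCount_le (P tx) i
  have := hg.pyr_one_pos tx hsx hxg
  have := hguard₂ tx hsx hxg
  have hzx : partCount (P tx) i (.pyr 0) = 0 := by omega
  refine .inl (hg.hasPhase h hs fun t ht ht' => ?_)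
  by_contra! hlt
  have hsum := add_partCount_le (P t) i
  have := hg.pyr_one_pos t ht ht'
  have := hguard₀ t ht ht'
  simp only [Bool.not_true] at hlt
  have hbar : .bar i hq ∉ P t :=
    notMem_of_partCount_eq_zero (show partCount (P t) i .bar = 0 by omega)
  rcases le_total t tx with htx | htx
  · exact h.bar_notMem_of_pyr_two hq hg hs ht htx hxg (by omega) hbar
      (h.bar_mem_of_pyr_zero hq hg hs hsx le_rfl (hxg.trans h.lt.le) hzx)
  · exact hbar (h.bar_mem_of_pyr_zero hq hg hs hsx htx (ht'.trans h.lt.le) hzx)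

end Existential

theorem IsBlockRun.exists_hasPhase (h : IsBlockRun P i t₀ tg t₂) (hq : Φ.quant i = .ex) :
    ∃ b, HasPhase P i b t₀ t₂ := by
  obtain ⟨s, hs, hg⟩ := h.exists_isGuarded (isBuiltOn_lit (belowLit_ex_true hq))
    (isBuiltOn_bar_lit_false hq) (by decide) (by decide) (by decide) (by decide)
    (not_pyrOpen_of_mem (v := .lit i true) (.inr ⟨rfl, by simp [part]⟩)
      (h.mem_of_adj_wit _ (lit_true_adj_wit i)))
    (not_pyrOpen_of_mem (v := .lit i false) (.inr ⟨rfl, by simp [part]⟩)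
      (h.mem_of_adj_wit _ ((adj_wit_ex_iff hq).mpr (.inr (.inr (.inr rfl))))))
  rcases h.hasPhase_or hq hg hs with hb | hb
  · exact ⟨true, hb⟩
  · exact ⟨false, hb⟩

/-- The rest of the graph is pebbled again after `tg`. -/
theorem IsBlockRun.hasPhase_false_of_pyrOpen (h : IsBlockRun P i t₀ tg t₂)
    (hq : Φ.quant i = .all) (ho : PyrOpen i 2 ∅ (P tg)) : HasPhase P i false t₀ t₂ := by
  have hle := h.le
  obtain ⟨τ, hleτ, hltτ, -, -, hcard, hclosed⟩ := isBuiltOn_empty.exists_closing h.blackMove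
    h.lt.le ho (not_pyrOpen_of_mem (.inl rfl)
      (h.mem_of_adj_out _ ((adj_out_all_iff hq).mpr (.inr (.inr (.inl rfl))))))
  have hguard₀ t (ht : tg < t) (ht' : t ≤ t₂) :
      0 < partCount (P t) i (.pyr 0) + partCount (P t) i (.lit false) := by
    by_contra! hz
    obtain ⟨t', hle', hlt', hpred, -⟩ := exists_last_placement h.blackMove ht'
      (notMem_of_partCount_eq_zero (v := .lit i false)
        (show partCount (P t) i (.lit false) = 0 by omega))
      (h.mem_of_adj_out _ ((adj_out_all_iff hq).mpr (.inr (.inr (.inr rfl)))))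
    exact h.apex_zero_notMem (by omega) hle' hlt'.le (by omega)
      (fun u hu hu' => Nat.add_pos_right _ (h.wit_pos (by omega) (by omega)))
      (hpred _ (adj_lit_iff.mpr (belowLit_all_false hq).symm))
  have hbudget := h.budget (τ + 1) (by omega) hltτ
  have hsum := add_partCount_le (P (τ + 1)) i
  have hsize := pyramidSize_two i
  have := hguard₀ (τ + 1) (by omega) hltτ
  have := h.wit_pos (t := τ + 1) (by omega) hltτ
  refine ⟨τ + 1, t₂, by omega, hltτ, le_rfl, block_lt_of_countFrom_eq_zero (by omega),
    h.mem_of_adj_out _ ((adj_out_all_iff hq).mpr (.inl rfl)), fun t ht ht' => ?_⟩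
  have := hguard₀ t (by omega) ht'
  have := h.wit_pos (t := t) (by omega) ht'
  have hguard₂ := partCount_pos_of_not_pyrOpen (hclosed t ht ht')
  have hsum := add_partCount_le (P t) i
  simp only [Finset.sum_empty, Bool.not_false] at hguard₂ ⊢
  omega

theorem IsBlockRun.hasPhase_all (h : IsBlockRun P i t₀ tg t₂) (hq : Φ.quant i = .all) (b : Bool) :
    HasPhase P i b t₀ t₂ := by
  have hc₀ : ¬ PyrOpen i 0 ∅ (P tg) := not_pyrOpen_of_mem (.inl rfl)
    (h.mem_of_adj_wit _ ((adj_wit_all_iff hq).mpr (.inr (.inr (.inr rfl)))))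
  rcases b with _ | _
  · by_cases ho : PyrOpen i 2 ∅ (P tg)
    · exact h.hasPhase_false_of_pyrOpen hq ho
    obtain ⟨s, hs, hg⟩ := h.exists_isGuarded isBuiltOn_empty isBuiltOn_empty (by decide)
      (by decide) (by decide) (by decide) hc₀ ho
    refine hg.hasPhase h hs fun t ht ht' => ?_
    have hguard₀ := partCount_pos_of_not_pyrOpen (hg.not_pyrOpen_zero t ht ht')
    have hguard₁ := hg.pyr_one_pos t ht ht'
    have hguard₂ := partCount_pos_of_not_pyrOpen (hg.not_pyrOpen_two t ht ht')
    have hsum := add_partCount_le (P t) i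
    simp only [Finset.sum_empty, Bool.not_false] at hguard₀ hguard₂ ⊢
    omega
  · obtain ⟨s, hs, hg⟩ := h.exists_isGuarded isBuiltOn_empty
      (isBuiltOn_lit (belowLit_all_true hq)) (by decide) (by decide) (by decide) (by decide) hc₀
      (not_pyrOpen_of_mem (v := .lit i true) (.inr ⟨rfl, by simp [part]⟩)
        (h.mem_of_adj_wit _ (lit_true_adj_wit i)))
    refine hg.hasPhase h hs fun t ht ht' => ?_
    have hguard₀ := partCount_pos_of_not_pyrOpen (hg.not_pyrOpen_zero t ht ht')
    have hguard₁ := hg.pyr_one_pos t ht ht'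
    have hguard₂ := partCount_pos_of_not_pyrOpen (hg.not_pyrOpen_two t ht ht')
    have hsum := add_partCount_le (P t) i
    simp only [Finset.sum_empty, Finset.sum_singleton, Bool.not_true] at hguard₀ hguard₂ ⊢
    omega

end QCNF

/-! ### A pebbling strategy proves the formula -/

namespace QCNF

variable {Φ : QCNF} {P : ℕ → Finset Φ.Vertex} {Q : Finset Φ.Vertex} {c : Fin Φ.numClauses}
  {σ : Fin Φ.numVars → Bool} {i t₀ t₁ : ℕ}

theorem exists_chk_placement (hP : ∀ t, BlackMove Φ.gltGraph (P t) (P (t + 1)))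
    (h₀ : ∀ v ∈ P t₀, block v < Φ.numVars) (j : Fin (Φ.numClauses + 1)) (hcj : c.val < j.val)
    (h : t₀ ≤ t₁) (h₁ : .chk j ∈ P t₁) :
    ∃ t, t₀ ≤ t ∧ t ≤ t₁ ∧ .chk c.succ ∈ P t ∧ ∀ u, Φ.gltGraph.Adj u (.chk c.succ) → u ∈ P t := by
  induction j using Fin.induction generalizing t₁ with
  | zero => exact absurd hcj (Nat.not_lt_zero _)
  | succ j ih =>
    obtain ⟨τ, hle, hlt, hpred, hstay⟩ :=
      exists_last_placement hP h (fun hm => (h₀ _ hm).ne rfl) h₁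
    rcases (Nat.lt_succ_iff.mp hcj).lt_or_eq with hcj | hcj
    · obtain ⟨t, ht₀, ht, hc⟩ := ih hcj hle (hpred _ (adj_chk_succ_iff.mpr (.inl rfl)))
      exact ⟨t, ht₀, ht.trans hlt.le, hc⟩
    obtain rfl : c = j := Fin.ext hcj
    have hm := hstay (τ + 1) (Nat.lt_succ_self τ) hlt
    rcases hP τ with ⟨v, hv, -⟩ | hsub
    · exact ⟨τ + 1, Nat.le_succ_of_le hle, hlt, hm,
        fun u hu => hv ▸ Finset.mem_insert_of_mem (hpred u hu)⟩
    · exact ⟨τ, hle, hlt.le, hsub hm, hpred⟩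

theorem five_le_countFrom_add_card (hc : .chk c.succ ∈ Q)
    (hpred : ∀ u, Φ.gltGraph.Adj u (.chk c.succ) → u ∈ Q) :
    5 ≤ countFrom Q Φ.numVars + (Φ.clauses.get c).1.card := by
  let pads : Finset Φ.Vertex := Finset.univ.image (.pad c)
  have hpads : pads.card = 3 - (Φ.clauses.get c).1.card := by
    rw [Finset.card_image_of_injective _ fun k k' h => eq_of_heq (Vertex.pad.inj h).2,
      Finset.card_univ, Fintype.card_fin]
  have hcard : (insert (.chk c.succ) (insert (.chk c.castSucc) pads)).card = pads.card + 2 := by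
    rw [Finset.card_insert_of_notMem, Finset.card_insert_of_notMem] <;>
      simp [pads, Fin.ext_iff]
  have hsub : insert (.chk c.succ) (insert (.chk c.castSucc) pads) ⊆
      Q.filter fun v => Φ.numVars ≤ block v := by
    intro v hv
    simp only [pads, Finset.mem_insert, Finset.mem_image, Finset.mem_univ, true_and] at hv
    rw [Finset.mem_filter]
    rcases hv with rfl | rfl | ⟨k, rfl⟩
    · exact ⟨hc, le_rfl⟩
    · exact ⟨hpred _ (adj_chk_succ_iff.mpr (.inl rfl)), le_rfl⟩
    · exact ⟨hpred _ (adj_chk_succ_iff.mpr (.inr (.inr ⟨k, rfl⟩))), le_rfl⟩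
  have hle : _ ≤ countFrom Q Φ.numVars := Finset.card_le_card hsub
  omega

theorem card_eq_sum_of_forall_false {n : ℕ} {σ : Fin n → Bool} {C : Finset (Literal n)}
    (h : ∀ l ∈ C, l.2 = !σ l.1) : C.card = ∑ j, if (j, !σ j) ∈ C then 1 else 0 := by
  rw [← Finset.card_filter, ← Finset.card_image_of_injective _
    (show Function.Injective fun j => (j, !σ j) from fun _ _ he => congrArg Prod.fst he)]
  congr 1
  ext l
  simp only [Finset.mem_image, Finset.mem_filter, Finset.mem_univ, true_and]
  constructor
  · exact fun hl => ⟨l.1, h l hl ▸ hl, by rw [← h l hl]⟩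
  · rintro ⟨j, hj, rfl⟩
    exact hj

/-- If all literals of a clause are false, then checking it takes five pebbles besides the three
on each block. -/
theorem satAll_of_pebbled (hP : ∀ t, BlackMove Φ.gltGraph (P t) (P (t + 1)))
    (hK : ∀ t, (P t).card ≤ 3 * Φ.numVars + 4) (h : t₀ ≤ t₁)
    (h₀ : ∀ v ∈ P t₀, block v < Φ.numVars) (h₁ : .chk (Fin.last _) ∈ P t₁)
    (hinv : ∀ t, t₀ ≤ t → t ≤ t₁ → ∀ j : Fin Φ.numVars,
      3 + partCount (P t) j (.lit (!σ j)) ≤ blockCount (P t) j) :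
    BoolFormula.SatAll σ Φ.clauses := by
  intro C hC
  obtain ⟨c, rfl⟩ : ∃ c : Fin Φ.numClauses, Φ.clauses.get c = C := List.mem_iff_get.mp hC
  by_contra! hunsat
  have hfalse l (hl : l ∈ (Φ.clauses.get c).1) : l.2 = !σ l.1 :=
    Bool.eq_not.mpr (hunsat l hl).symm
  obtain ⟨t, ht₀, ht₁, hc, hpred⟩ := exists_chk_placement hP h₀ (Fin.last _) c.2 h h₁
  have hblock (j : Fin Φ.numVars) :
      3 + (if (j, !σ j) ∈ (Φ.clauses.get c).1 then 1 else 0) ≤ blockCount (P t) j := by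
    refine le_trans (Nat.add_le_add_left ?_ 3) (hinv t ht₀ ht₁ j)
    split_ifs with hj
    · exact partCount_pos (hpred _ (adj_chk_succ_iff.mpr (.inr (.inl ⟨_, hj, rfl⟩))))
    · exact Nat.zero_le _
  have hsum := Finset.sum_le_sum fun j (_ : j ∈ Finset.univ) => hblock j
  rw [Finset.sum_add_distrib, ← card_eq_sum_of_forall_false hfalse, Finset.sum_const,
    Finset.card_univ, Fintype.card_fin, smul_eq_mul, ← Finset.sum_range (blockCount (P t))] at hsum
  have hfive := five_le_countFrom_add_card hc hpred
  have htotal := sum_blockCount_add_countFrom (P t) Φ.numVars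
  have := hK t
  omega

theorem trueFrom_of_pebbled (hP : ∀ t, BlackMove Φ.gltGraph (P t) (P (t + 1)))
    (hK : ∀ t, (P t).card ≤ 3 * Φ.numVars + 4) (hi : i ≤ Φ.numVars) (h : t₀ ≤ t₁)
    (h₀ : ∀ v ∈ P t₀, block v < i) (h₁ : Φ.outFrom i ∈ P t₁)
    (hinv : ∀ t, t₀ ≤ t → t ≤ t₁ → ∀ j : Fin Φ.numVars, j.val < i →
      3 + partCount (P t) j (.lit (!σ j)) ≤ blockCount (P t) j) :
    TrueFrom Φ.quant (fun ρ => BoolFormula.SatAll ρ Φ.clauses) i σ := by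
  induction hi using Nat.decreasingInduction generalizing t₀ t₁ σ with
  | self =>
    rw [outFrom_of_le le_rfl] at h₁
    exact (trueFrom_of_le le_rfl).mpr <|
      satAll_of_pebbled hP hK h h₀ h₁ fun t ht ht' j => hinv t ht ht' j j.2
  | of_succ i hi ih =>
    have hi : i < Φ.numVars := hi
    rw [outFrom_of_lt hi] at h₁
    have hbudget t (ht : t₀ ≤ t) (ht' : t ≤ t₁) :
        blockCount (P t) i + countFrom (P t) (i + 1) ≤ 3 * (Φ.numVars - i) + 4 := by
      have hsum : i * 3 ≤ ∑ j ∈ Finset.range i, blockCount (P t) j := by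
        refine le_of_eq_of_le (by simp) (Finset.card_nsmul_le_sum _ _ 3 fun j hj => ?_)
        rw [Finset.mem_range] at hj
        exact (Nat.le_add_right _ _).trans (hinv t ht ht' ⟨j, hj.trans hi⟩ hj)
      have htotal := sum_blockCount_add_countFrom (P t) i
      rw [countFrom_eq] at htotal
      have := hK t
      omega
    obtain ⟨tg, t₂, ht₂, hrun⟩ := exists_isBlockRun (i := ⟨i, hi⟩) hP h h₀ h₁ hbudget
    have of_hasPhase {b} (hphase : HasPhase P ⟨i, hi⟩ b t₀ t₂) :
        TrueFrom Φ.quant (fun ρ => BoolFormula.SatAll ρ Φ.clauses) (i + 1)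
          (Function.update σ ⟨i, hi⟩ b) := by
      obtain ⟨u₀, u₁, hu₀, hu, hu₁, hempty, hout, hcount⟩ := hphase
      refine ih hu hempty hout fun t ht ht' j hj => ?_
      rcases eq_or_ne j ⟨i, hi⟩ with rfl | hne
      · simpa only [Function.update_self] using hcount t ht ht'
      · rw [Function.update_of_ne hne]
        have hji : j.val ≠ i := Fin.val_ne_of_ne hne
        exact hinv t (by omega) (by omega) j (by omega)
    rcases hq : Φ.quant ⟨i, hi⟩ with _ | _
    · exact (trueFrom_all hi hq).mpr fun b => of_hasPhase (hrun.hasPhase_all hq b)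
    · obtain ⟨b, hb⟩ := hrun.exists_hasPhase hq
      exact (trueFrom_ex hi hq).mpr ⟨b, of_hasPhase hb⟩

theorem isTrue_of_pebbled (hP : ∀ t, BlackMove Φ.gltGraph (P t) (P (t + 1)))
    (hK : ∀ t, (P t).card ≤ 3 * Φ.numVars + 4) (h₀ : P 0 = ∅) (h₁ : Φ.outFrom 0 ∈ P t₁) :
    Φ.IsTrue :=
  (quantTrue_iff_trueFrom fun _ => false).mpr <|
    trueFrom_of_pebbled hP hK (Nat.zero_le _) (Nat.zero_le t₁) (by simp [h₀]) h₁
      fun _ _ _ _ hj => absurd hj (Nat.not_lt_zero _)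

end QCNF

/-! ### Black pebbling strategies -/

section BlackReach

variable {V : Type*} [DecidableEq V] {G : Digraph V} {k m r : ℕ} {P P' Q H : Finset V}
  {l l' l'' : List V} {v : V}

/-- `P'` can be reached from `P` in the black pebble game with at most `k` pebbles. -/
def BlackReach (G : Digraph V) (k : ℕ) : Finset V → Finset V → Prop :=
  Relation.ReflTransGen fun P P' => BlackMove G P P' ∧ P'.card ≤ k

namespace BlackReach

theorem trans (h : BlackReach G k P Q) (h' : BlackReach G k Q P') : BlackReach G k P P' :=
  Relation.ReflTransGen.trans h h'

theorem place (h : ∀ u, G.Adj u v → u ∈ P) (hk : P.card + 1 ≤ k) :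
    BlackReach G k P (insert v P) :=
  .single ⟨.inl ⟨v, rfl, h⟩, (Finset.card_insert_le _ _).trans hk⟩

theorem drop (h : P' ⊆ P) (hk : P'.card ≤ k) : BlackReach G k P P' :=
  .single ⟨.inr h, hk⟩

theorem union_right (h : BlackReach G m P P') (H : Finset V) (hk : m + H.card ≤ k) :
    BlackReach G k (P ∪ H) (P' ∪ H) := by
  refine Relation.ReflTransGen.lift (· ∪ H) ?_ _ _ h
  rintro P P' ⟨⟨v, rfl, hv⟩ | hs, hc⟩
  · exact ⟨.inl ⟨v, Finset.insert_union _ _ _, fun u hu => Finset.mem_union_left _ (hv u hu)⟩,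
      (Finset.card_union_le _ _).trans (by omega)⟩
  · exact ⟨.inr (Finset.union_subset_union_left hs), (Finset.card_union_le _ _).trans (by omega)⟩

theorem mono (h : BlackReach G m P P') (hk : m ≤ k) : BlackReach G k P P' := by
  simpa using h.union_right ∅ (by simpa using hk)

theorem place_all (W : Finset V) (h : ∀ w ∈ W, w ∈ P ∨ ∀ u, G.Adj u w → u ∈ P)
    (hk : P.card + W.card ≤ k) : BlackReach G k P (W ∪ P) := by
  induction W using Finset.induction_on with
  | empty => exact (Finset.empty_union P).symm ▸ .refl
  | insert w W hw ih =>
    rw [Finset.card_insert_of_notMem hw] at hk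
    refine (ih (fun w hw => h w (Finset.mem_insert_of_mem hw)) (by omega)).trans ?_
    rw [Finset.insert_union]
    rcases h w (Finset.mem_insert_self _ _) with hwP | hpred
    · rw [Finset.insert_eq_of_mem (Finset.mem_union_right _ hwP)]
      exact .refl
    · have := Finset.card_union_le W P
      exact .place (fun u hu => Finset.mem_union_right _ (hpred u hu)) (by omega)

/-- Pebble the two predecessors one after the other; the first one keeps a pebble meanwhile. -/
theorem triangle {φ : ℕ → ℕ → V} (hφ : ∀ a b, a + b ≤ r → ∀ u, G.Adj u (φ a b) →
      a + b < r ∧ (u = φ (a + 1) b ∨ u = φ a (b + 1))) {a b d : ℕ} (hd : a + b + d = r) :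
    BlackReach G (d + 2) ∅ {φ a b} := by
  induction d generalizing a b with
  | zero =>
    exact .place (P := ∅) (fun u hu => absurd (hφ a b (by omega) u hu).1 (by omega)) (by simp)
  | succ d ih =>
    have hleft : BlackReach G (d + 3) ∅ {φ (a + 1) b} := (ih (by omega)).mono (by omega)
    have hright := (ih (a := a) (b := b + 1) (by omega)).union_right (k := d + 3)
      {φ (a + 1) b} (by simp)
    rw [Finset.empty_union] at hright
    have hplace : BlackReach G (d + 3) ({φ a (b + 1)} ∪ {φ (a + 1) b})
        (insert (φ a b) ({φ a (b + 1)} ∪ {φ (a + 1) b})) := by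
      refine .place (fun u hu => ?_) ((Nat.add_le_add_right (Finset.card_union_le _ _) 1).trans ?_)
      · rcases (hφ a b (by omega) u hu).2 with rfl | rfl <;> simp
      · simp only [Finset.card_singleton]
        omega
    exact hleft.trans (hright.trans (hplace.trans (.drop (by simp) (by simp))))

end BlackReach

/-- With at most `k` pebbles, the list `l'` can be reached from the list `l` while the set `H`
keeps its pebbles. -/
def ReachKeeping (G : Digraph V) (k : ℕ) (H : Finset V) (l l' : List V) : Prop :=
  BlackReach G k (l.toFinset ∪ H) (l'.toFinset ∪ H)

namespace ReachKeeping

theorem trans (h : ReachKeeping G k H l l') (h' : ReachKeeping G k H l' l'') :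
    ReachKeeping G k H l l'' :=
  BlackReach.trans h h'

instance : Trans (ReachKeeping G k H) (ReachKeeping G k H) (ReachKeeping G k H) := ⟨trans⟩

theorem card_union_le : (l.toFinset ∪ H).card ≤ l.length + H.card :=
  (Finset.card_union_le _ _).trans (Nat.add_le_add_right l.toFinset_card_le _)

theorem place (h : ∀ u, G.Adj u v → u ∈ l) (hl : l' ⊆ v :: l) (hk : l.length + 1 + H.card ≤ k) :
    ReachKeeping G k H l l' := by
  have hcard := card_union_le (l := l) (H := H)
  have hsub : l'.toFinset ∪ H ⊆ insert v (l.toFinset ∪ H) := by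
    rw [← Finset.insert_union, ← List.toFinset_cons]
    exact Finset.union_subset_union_left (fun w hw =>
      List.mem_toFinset.mpr (hl (List.mem_toFinset.mp hw)))
  exact BlackReach.trans
    (.place (fun u hu => Finset.mem_union_left _ (List.mem_toFinset.mpr (h u hu))) (by omega))
    (.drop hsub <| (Finset.card_le_card hsub).trans <|
      (Finset.card_insert_le _ _).trans (by omega))

theorem of_blackReach (h : BlackReach G m ∅ {v}) (hk : m + l.length + H.card ≤ k) :
    ReachKeeping G k H l (v :: l) := by
  have hcard := card_union_le (l := l) (H := H)
  have hreach := h.union_right (k := k) (l.toFinset ∪ H) (by omega)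
  rwa [Finset.empty_union, ← Finset.insert_eq, ← Finset.insert_union, ← List.toFinset_cons]
    at hreach

end ReachKeeping

end BlackReach

namespace QCNF

variable {Φ : QCNF} {H : Finset Φ.Vertex} {σ : Fin Φ.numVars → Bool} {i k : ℕ}

section Block

variable {x : Fin Φ.numVars} {l l' : List Φ.Vertex}

theorem lt_pyramidSize_of_adj_pyrGrid {r : Fin 3} {a b : ℕ} {u : Φ.Vertex}
    (h : a + b < Φ.pyramidSize x r) (hu : Φ.gltGraph.Adj u (pyrGrid x r a b)) :
    a + b + 1 < Φ.pyramidSize x r ∧ (u = pyrGrid x r (a + 1) b ∨ u = pyrGrid x r a (b + 1)) := by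
  rw [pyrGrid, dif_pos h, adj_pyr_iff] at hu
  obtain ⟨⟨⟨⟨a', ha'⟩, ⟨b', hb'⟩⟩, hw⟩, ⟨ha, hb⟩ | ⟨ha, hb⟩, rfl⟩ := hu
  · obtain rfl : a' = a + 1 := ha
    obtain rfl : b' = b := congrArg Fin.val hb
    exact ⟨by simp only at hw; omega, .inl (by rw [pyrGrid, dif_pos hw])⟩
  · obtain rfl : a' = a := congrArg Fin.val ha
    obtain rfl : b' = b + 1 := hb
    exact ⟨by simp only at hw; omega, .inr (by rw [pyrGrid, dif_pos hw])⟩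

theorem blackReach_apex (x : Fin Φ.numVars) (r : Fin 3) :
    BlackReach Φ.gltGraph (Φ.pyramidSize x r + 1) ∅ {Φ.apex x r} := by
  have hs := Φ.pyramidSize_pos x r
  have h := BlackReach.triangle (G := Φ.gltGraph) (φ := pyrGrid x r)
    (r := Φ.pyramidSize x r - 1) (a := 0) (b := 0) (d := Φ.pyramidSize x r - 1)
    (fun a b hab u hu => by
      obtain ⟨hlt, hu⟩ := lt_pyramidSize_of_adj_pyrGrid (by omega) hu
      exact ⟨by omega, hu⟩) (by omega)
  rw [pyrGrid_zero] at h
  exact h.mono (by omega)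

variable (hk : 3 * (Φ.numVars - x) + 4 + H.card ≤ k)

include hk

theorem reachKeeping_apex (r : Fin 3) (hl : l.length ≤ r) :
    ReachKeeping Φ.gltGraph k H l (Φ.apex x r :: l) := by
  refine .of_blackReach (blackReach_apex x r) ?_
  unfold pyramidSize
  omega

theorem reachKeeping_place {v : Φ.Vertex} (h : ∀ u, Φ.gltGraph.Adj u v → u ∈ l)
    (hl : l' ⊆ v :: l) (hlen : l.length ≤ 6 := by simp) :
    ReachKeeping Φ.gltGraph k H l l' :=
  .place h hl (by omega)

theorem reachKeeping_apexes :
    ReachKeeping Φ.gltGraph k H [] [Φ.apex x 2, Φ.apex x 1, Φ.apex x 0] :=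
  (reachKeeping_apex hk 0 le_rfl).trans <|
    (reachKeeping_apex hk 1 le_rfl).trans (reachKeeping_apex hk 2 le_rfl)

theorem reachKeeping_out_of_ex_true (hq : Φ.quant x = .ex)
    (hrest : ReachKeeping Φ.gltGraph k H [.lit x true, .bar x hq, Φ.apex x 1]
      [Φ.outFrom (x.val + 1), .lit x true, .bar x hq, Φ.apex x 1]) :
    ReachKeeping Φ.gltGraph k H [] [.out x] :=
  calc ReachKeeping Φ.gltGraph k H []
        [Φ.apex x 2, Φ.apex x 1, Φ.apex x 0] := reachKeeping_apexes hk
    ReachKeeping _ _ _ _ [.bar x hq, Φ.apex x 1, Φ.apex x 0] :=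
      reachKeeping_place hk (v := .bar x hq) (by simp [adj_bar_iff]) (by simp)
    ReachKeeping _ _ _ _ [.lit x true, .bar x hq, Φ.apex x 1] :=
      reachKeeping_place hk (v := .lit x true) (by simp [adj_lit_iff, belowLit_ex_true hq])
        (by simp)
    ReachKeeping _ _ _ _ [Φ.outFrom (x.val + 1), .lit x true, .bar x hq, Φ.apex x 1] := hrest
    ReachKeeping _ _ _ _
        [.lit x false, Φ.outFrom (x.val + 1), .lit x true, .bar x hq, Φ.apex x 1] :=
      reachKeeping_place hk (v := .lit x false) (by simp [adj_lit_iff, belowLit_ex_false hq])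
        (by simp)
    ReachKeeping _ _ _ _ [.wit x, .bar x hq] :=
      reachKeeping_place hk (v := .wit x) (by simp [adj_wit_ex_iff hq]) (by simp)
    ReachKeeping _ _ _ _ [.out x] :=
      reachKeeping_place hk (v := .out x) (by simp [adj_out_ex_iff hq]) (by simp)

/-- The vertex `bar` is pebbled twice: to keep the apex of the first pyramid instead, which is
needed for the positive literal, its pebble has to be removed in between. -/
theorem reachKeeping_out_of_ex_false (hq : Φ.quant x = .ex)
    (hrest : ReachKeeping Φ.gltGraph k H [.lit x false, Φ.apex x 1, Φ.apex x 0]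
      [Φ.outFrom (x.val + 1), .lit x false, Φ.apex x 1, Φ.apex x 0]) :
    ReachKeeping Φ.gltGraph k H [] [.out x] :=
  calc ReachKeeping Φ.gltGraph k H []
        [Φ.apex x 2, Φ.apex x 1, Φ.apex x 0] := reachKeeping_apexes hk
    ReachKeeping _ _ _ _ [.bar x hq, Φ.apex x 1, Φ.apex x 0] :=
      reachKeeping_place hk (v := .bar x hq) (by simp [adj_bar_iff]) (by simp)
    ReachKeeping _ _ _ _ [.lit x false, Φ.apex x 1, Φ.apex x 0] :=
      reachKeeping_place hk (v := .lit x false) (by simp [adj_lit_iff, belowLit_ex_false hq])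
        (by simp)
    ReachKeeping _ _ _ _ [Φ.outFrom (x.val + 1), .lit x false, Φ.apex x 1, Φ.apex x 0] := hrest
    ReachKeeping _ _ _ _
        [.lit x true, Φ.outFrom (x.val + 1), .lit x false, Φ.apex x 1, Φ.apex x 0] :=
      reachKeeping_place hk (v := .lit x true) (by simp [adj_lit_iff, belowLit_ex_true hq])
        (by simp)
    ReachKeeping _ _ _ _ [.wit x, Φ.apex x 0] :=
      reachKeeping_place hk (v := .wit x) (by simp [adj_wit_ex_iff hq]) (by simp)
    ReachKeeping _ _ _ _ [Φ.apex x 2, .wit x, Φ.apex x 0] := reachKeeping_apex hk 2 le_rfl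
    ReachKeeping _ _ _ _ [.bar x hq, .wit x] :=
      reachKeeping_place hk (v := .bar x hq) (by simp [adj_bar_iff]) (by simp)
    ReachKeeping _ _ _ _ [.out x] :=
      reachKeeping_place hk (v := .out x) (by simp [adj_out_ex_iff hq]) (by simp)

/-- The rest of the graph is pebbled twice: first for `wit` while the positive literal is held,
then for `out` while the negative literal is held. -/
theorem reachKeeping_out_of_all (hq : Φ.quant x = .all)
    (htrue : ReachKeeping Φ.gltGraph k H [.lit x true, Φ.apex x 1, Φ.apex x 0]
      [Φ.outFrom (x.val + 1), .lit x true, Φ.apex x 1, Φ.apex x 0])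
    (hfalse : ReachKeeping Φ.gltGraph k H [Φ.apex x 2, .lit x false, .wit x]
      [Φ.outFrom (x.val + 1), Φ.apex x 2, .lit x false, .wit x]) :
    ReachKeeping Φ.gltGraph k H [] [.out x] :=
  calc ReachKeeping Φ.gltGraph k H []
        [Φ.apex x 2, Φ.apex x 1, Φ.apex x 0] := reachKeeping_apexes hk
    ReachKeeping _ _ _ _ [.lit x true, Φ.apex x 1, Φ.apex x 0] :=
      reachKeeping_place hk (v := .lit x true) (by simp [adj_lit_iff, belowLit_all_true hq])
        (by simp)
    ReachKeeping _ _ _ _ [Φ.outFrom (x.val + 1), .lit x true, Φ.apex x 1, Φ.apex x 0] := htrue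
    ReachKeeping _ _ _ _ [.wit x, Φ.apex x 0] :=
      reachKeeping_place hk (v := .wit x) (by simp [adj_wit_all_iff hq]) (by simp)
    ReachKeeping _ _ _ _ [.lit x false, .wit x] :=
      reachKeeping_place hk (v := .lit x false) (by simp [adj_lit_iff, belowLit_all_false hq])
        (by simp)
    ReachKeeping _ _ _ _ [Φ.apex x 2, .lit x false, .wit x] := reachKeeping_apex hk 2 le_rfl
    ReachKeeping _ _ _ _ [Φ.outFrom (x.val + 1), Φ.apex x 2, .lit x false, .wit x] := hfalse
    ReachKeeping _ _ _ _ [.out x] :=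
      reachKeeping_place hk (v := .out x) (by simp [adj_out_all_iff hq]) (by simp)

end Block

/-- `H` carries at most three pebbles for each variable before `xᵢ`, among them the literal that is
true under `σ` and the vertex below the other literal. -/
structure Holds (Φ : QCNF) (i : ℕ) (σ : Fin Φ.numVars → Bool) (H : Finset Φ.Vertex) : Prop where
  card_le : H.card ≤ 3 * i
  lit_mem : ∀ j : Fin Φ.numVars, j.val < i → .lit j (σ j) ∈ H
  belowLit_mem : ∀ j : Fin Φ.numVars, j.val < i → Φ.belowLit j (!σ j) ∈ H

theorem Holds.update (h : Holds Φ i σ H) (hi : i < Φ.numVars) (b : Bool) {l : List Φ.Vertex}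
    (hl : l.length = 3) (hlit : .lit ⟨i, hi⟩ b ∈ l) (hbelow : Φ.belowLit ⟨i, hi⟩ (!b) ∈ l) :
    Holds Φ (i + 1) (Function.update σ ⟨i, hi⟩ b) (l.toFinset ∪ H) := by
  refine ⟨?_, fun j hj => ?_, fun j hj => ?_⟩
  · have := ReachKeeping.card_union_le (l := l) (H := H)
    have := h.card_le
    omega
  all_goals
    rw [Finset.mem_union, List.mem_toFinset]
    rcases (Nat.lt_succ_iff.mp hj).lt_or_eq with hj | rfl
  · rw [Function.update_of_ne fun he => hj.ne (congrArg Fin.val he)]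
    exact .inr (h.lit_mem j hj)
  · exact .inl (by rwa [Function.update_self])
  · rw [Function.update_of_ne fun he => hj.ne (congrArg Fin.val he)]
    exact .inr (h.belowLit_mem j hj)
  · exact .inl (by rwa [Function.update_self])

theorem Holds.lit_mem_or_placeable (h : Holds Φ Φ.numVars σ H) (l : Literal Φ.numVars) :
    .lit l.1 l.2 ∈ H ∨ ∀ u, Φ.gltGraph.Adj u (.lit l.1 l.2) → u ∈ H := by
  by_cases hl : σ l.1 = l.2
  · exact .inl (hl ▸ h.lit_mem l.1 l.1.2)
  · refine .inr fun u hu => ?_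
    rw [adj_lit_iff.mp hu, ← Bool.not_eq.mpr hl]
    exact h.belowLit_mem l.1 l.1.2

/-- The inputs of the vertex of the clause `c` other than the preceding clause vertex and the vertex
of the literal `l`, which need pebbles of their own if `l` is already pebbled. -/
def otherInputs (c : Fin Φ.numClauses) (l : Literal Φ.numVars) : Finset Φ.Vertex :=
  (((Φ.clauses.get c).1.erase l).image fun l' => .lit l'.1 l'.2) ∪ Finset.univ.image (.pad c)

theorem card_otherInputs_le {c : Fin Φ.numClauses} {l : Literal Φ.numVars}
    (hl : l ∈ (Φ.clauses.get c).1) : (otherInputs c l).card ≤ 2 := by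
  refine (Finset.card_union_le _ _).trans ((Nat.add_le_add Finset.card_image_le
    Finset.card_image_le).trans ?_)
  rw [Finset.card_erase_of_mem hl, Finset.card_univ, Fintype.card_fin]
  have := (Φ.clauses.get c).2
  have := Finset.card_pos.mpr ⟨l, hl⟩
  omega

theorem mem_otherInputs_of_adj_chk {c : Fin Φ.numClauses} {l : Literal Φ.numVars} {u : Φ.Vertex}
    (hu : Φ.gltGraph.Adj u (.chk c.succ)) :
    u = .chk c.castSucc ∨ u = .lit l.1 l.2 ∨ u ∈ otherInputs c l := by
  rw [otherInputs, Finset.mem_union, Finset.mem_image, Finset.mem_image]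
  rcases adj_chk_succ_iff.mp hu with rfl | ⟨l', hl', rfl⟩ | ⟨k, rfl⟩
  · exact .inl rfl
  · rcases eq_or_ne l' l with rfl | hne
    · exact .inr (.inl rfl)
    · exact .inr (.inr (.inl ⟨l', Finset.mem_erase.mpr ⟨hne, hl'⟩, rfl⟩))
  · exact .inr (.inr (.inr ⟨k, Finset.mem_univ k, rfl⟩))

/-- A true literal of the clause is in `H`, so at most two vertices besides the pebbles of `H` and
the two clause vertices are needed. -/
theorem Holds.blackReach_chk_succ (h : Holds Φ Φ.numVars σ H) {c : Fin Φ.numClauses}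
    (hc : ∃ l ∈ (Φ.clauses.get c).1, σ l.1 = l.2) :
    BlackReach Φ.gltGraph (3 * Φ.numVars + 4) (insert (.chk c.castSucc) H)
      (insert (.chk c.succ) H) := by
  obtain ⟨l₀, hl₀, hσl₀⟩ := hc
  have hplace : ∀ w ∈ otherInputs c l₀, w ∈ insert (.chk c.castSucc) H ∨
      ∀ u, Φ.gltGraph.Adj u w → u ∈ insert (.chk c.castSucc) H := by
    intro w hw
    rcases Finset.mem_union.mp hw with hw | hw
    · obtain ⟨l, -, rfl⟩ := Finset.mem_image.mp hw
      exact (h.lit_mem_or_placeable l).imp Finset.mem_insert_of_mem fun hu u hu' =>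
        Finset.mem_insert_of_mem (hu u hu')
    · obtain ⟨k, -, rfl⟩ := Finset.mem_image.mp hw
      exact .inr fun u hu => absurd hu not_adj_pad
  have hpred : ∀ u, Φ.gltGraph.Adj u (.chk c.succ) →
      u ∈ otherInputs c l₀ ∪ insert (.chk c.castSucc) H := by
    intro u hu
    rw [Finset.mem_union, Finset.mem_insert]
    rcases mem_otherInputs_of_adj_chk (l := l₀) hu with rfl | rfl | hu
    · exact .inr (.inl rfl)
    · exact .inr (.inr (hσl₀ ▸ h.lit_mem l₀.1 l₀.1.2))
    · exact .inl hu
  have hcard := h.card_le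
  have hother := card_otherInputs_le hl₀
  have hinsert (v : Φ.Vertex) := Finset.card_insert_le v H
  have hcast := hinsert (.chk c.castSucc)
  have hsucc := hinsert (.chk c.succ)
  have hunion := Finset.card_union_le (otherInputs c l₀) (insert (.chk c.castSucc) H)
  exact (BlackReach.place_all _ hplace (by omega)).trans <|
    (BlackReach.place hpred (by omega)).trans <|
      .drop (Finset.insert_subset_insert _ <| (Finset.subset_insert _ _).trans
        Finset.subset_union_right) (by omega)

theorem Holds.blackReach_chk (h : Holds Φ Φ.numVars σ H) (hσ : BoolFormula.SatAll σ Φ.clauses)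
    (j : Fin (Φ.numClauses + 1)) :
    BlackReach Φ.gltGraph (3 * Φ.numVars + 4) H (insert (.chk j) H) := by
  induction j using Fin.induction with
  | zero =>
    have := h.card_le
    exact .place (fun u hu => absurd hu not_adj_chk_zero) (by omega)
  | succ c ih => exact ih.trans (h.blackReach_chk_succ (hσ _ (List.get_mem Φ.clauses c)))

theorem Holds.blackReach_outFrom (h : Holds Φ i σ H) (hi : i ≤ Φ.numVars)
    (htrue : TrueFrom Φ.quant (fun ρ => BoolFormula.SatAll ρ Φ.clauses) i σ) :
    BlackReach Φ.gltGraph (3 * Φ.numVars + 4) H (insert (Φ.outFrom i) H) := by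
  induction hi using Nat.decreasingInduction generalizing σ H with
  | self =>
    rw [outFrom_of_le le_rfl]
    exact h.blackReach_chk ((trueFrom_of_le le_rfl).mp htrue) _
  | of_succ i hi ih =>
    have hi : i < Φ.numVars := hi
    let x : Fin Φ.numVars := ⟨i, hi⟩
    have hk : 3 * (Φ.numVars - x.val) + 4 + H.card ≤ 3 * Φ.numVars + 4 := by
      have := h.card_le
      have hx : x.val = i := rfl
      omega
    have hrest (b : Bool) (l : List Φ.Vertex)
        (hb : TrueFrom Φ.quant (fun ρ => BoolFormula.SatAll ρ Φ.clauses) (i + 1)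
          (Function.update σ x b)) (hl : l.length = 3) (hlit : .lit x b ∈ l)
        (hbelow : Φ.belowLit x (!b) ∈ l) :
        ReachKeeping Φ.gltGraph (3 * Φ.numVars + 4) H l (Φ.outFrom (x.val + 1) :: l) := by
      rw [ReachKeeping, List.toFinset_cons, Finset.insert_union]
      exact ih (h.update hi b hl hlit hbelow) hb
    suffices hx : ReachKeeping Φ.gltGraph (3 * Φ.numVars + 4) H [] [.out x] by
      simpa [ReachKeeping, ← Finset.insert_eq, outFrom_of_lt hi] using hx
    rcases hq : Φ.quant x with _ | _
    · have hall := (trueFrom_all hi hq).mp htrue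
      exact reachKeeping_out_of_all hk hq
        (hrest true _ (hall true) rfl (by simp) (by simp [belowLit_all_false hq]))
        (hrest false _ (hall false) rfl (by simp) (by simp [belowLit_all_true hq]))
    · obtain ⟨b, hb⟩ := (trueFrom_ex hi hq).mp htrue
      rcases b with _ | _
      · exact reachKeeping_out_of_ex_false hk hq
          (hrest false _ hb rfl (by simp) (by simp [belowLit_ex_true hq]))
      · exact reachKeeping_out_of_ex_true hk hq
          (hrest true _ hb rfl (by simp) (by simp [belowLit_ex_false hq]))

theorem blackReach_of_isTrue (h : Φ.IsTrue) :
    BlackReach Φ.gltGraph (3 * Φ.numVars + 4) ∅ {Φ.outFrom 0} :=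
  Holds.blackReach_outFrom (σ := fun _ => false) ⟨by simp, by simp, by simp⟩ (Nat.zero_le _)
    ((quantTrue_iff_trueFrom _).mp h)

end QCNF

/-! ### From the black to the spooky pebble game -/

section Spooky

variable {V : Type*} {G : Digraph V}

theorem exists_forall_not_adj_of_isAcyclic (hG : G.IsAcyclic) {A : Finset V} (hA : A.Nonempty) :
    ∃ v ∈ A, ∀ w ∈ A, ¬ G.Adj v w := by
  have : IsStrictOrder V (Function.swap (Relation.TransGen G.Adj)) :=
    { irrefl := hG, trans := fun _ _ _ h h' => h'.trans h }
  have : Nonempty A := hA.to_subtype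
  obtain ⟨v, -, hmin⟩ := (A.wellFoundedOn (r := Function.swap (Relation.TransGen G.Adj))).has_min
    Set.univ Set.univ_nonempty
  exact ⟨v.1, v.2, fun w hw h => hmin ⟨w, hw⟩ trivial (.single h)⟩

variable [DecidableEq V] {k r : ℕ} {P Q Q' A S : Finset V} {X Y Z : Finset V × Finset V} {o v : V}

/-- Reachability in the spooky pebble game with at most `k` pebbles. The first component of a
position is its set of pebbles, the second one its set of ghosts. -/
def SpookyReach (G : Digraph V) (k : ℕ) : Finset V × Finset V → Finset V × Finset V → Prop :=
  Relation.ReflTransGen fun X Y => SpookyMove G X.1 X.2 Y.1 Y.2 ∧ Y.1.card ≤ k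

namespace SpookyReach

theorem trans (h : SpookyReach G k X Y) (h' : SpookyReach G k Y Z) : SpookyReach G k X Z :=
  Relation.ReflTransGen.trans h h'

theorem exists_sequence (h : SpookyReach G k X Y) (hX : X.1.card ≤ k) :
    ∃ (T : ℕ) (P S : ℕ → Finset V), P 0 = X.1 ∧ S 0 = X.2 ∧ P T = Y.1 ∧ S T = Y.2 ∧
      (∀ t < T, SpookyMove G (P t) (S t) (P (t + 1)) (S (t + 1))) ∧ ∀ t ≤ T, (P t).card ≤ k := by
  induction h using Relation.ReflTransGen.head_induction_on with
  | refl => exact ⟨0, fun _ => Y.1, fun _ => Y.2, rfl, rfl, rfl, rfl, by simp, fun _ _ => hX⟩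
  | @head X Z hXZ _ ih =>
    obtain ⟨T, P, S, hP₀, hS₀, hP, hS, hmove, hcard⟩ := ih hXZ.2
    refine ⟨T + 1, fun | 0 => X.1 | t + 1 => P t, fun | 0 => X.2 | t + 1 => S t,
      rfl, rfl, hP, hS, ?_, ?_⟩
    · rintro (_ | t) ht
      · simpa only [hP₀, hS₀] using hXZ.1
      · exact hmove t (by omega)
    · rintro (_ | t) ht
      · exact hX
      · exact hcard t (by omega)

theorem pebble (h : ∀ u, G.Adj u v → u ∈ P) (hk : (insert v P).card ≤ k) :
    SpookyReach G k (P, S) (insert v P, S) :=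
  .single ⟨⟨v, .inl ⟨by rw [Finset.union_comm, Finset.insert_eq], rfl, h⟩⟩, hk⟩

/-- Turn the ghost into a pebble and take the pebble away. -/
theorem erase_ghost (h : ∀ u, G.Adj u v → u ∈ P) (hv : v ∉ P) (hk : P.card + 1 ≤ k) :
    SpookyReach G k (P, S) (P, S \ {v}) := by
  have herase : insert v P \ {v} = P := by
    rw [Finset.sdiff_singleton_eq_erase, Finset.erase_insert hv]
  have hunghost : SpookyReach G k (P, S) (insert v P, S \ {v}) :=
    .single ⟨⟨v, .inr (.inr (.inr ⟨by rw [Finset.union_comm, Finset.insert_eq], rfl, h⟩))⟩,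
      (Finset.card_insert_le v P).trans hk⟩
  have hunpebble : SpookyReach G k (insert v P, S \ {v}) (P, S \ {v}) :=
    .single ⟨⟨v, .inr (.inl ⟨herase.symm, rfl, fun u hu => Finset.mem_insert_of_mem (h u hu)⟩)⟩,
      (Nat.le_succ _).trans hk⟩
  exact hunghost.trans hunpebble

theorem ghost_sdiff (D : Finset V) (hk : P.card ≤ k) :
    SpookyReach G k (P, S) (P \ D, S ∪ D) := by
  induction D using Finset.induction_on with
  | empty =>
    rw [Finset.sdiff_empty, Finset.union_empty]
    exact .refl
  | insert v D _ ih =>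
    refine ih.trans (.single ⟨⟨v, .inr (.inr (.inl ⟨?_, ?_⟩))⟩,
      (Finset.card_le_card Finset.sdiff_subset).trans hk⟩)
    · rw [sdiff_sdiff_left, Finset.insert_eq, Finset.sup_eq_union, Finset.union_comm {v}]
    · rw [Finset.insert_eq, Finset.union_comm {v}, Finset.union_assoc]

theorem ghost (h : Q ⊆ P) (hk : P.card ≤ k) : SpookyReach G k (P, S) (Q, S ∪ (P \ Q)) := by
  simpa only [Finset.sdiff_sdiff_eq_self h] using ghost_sdiff (G := G) (S := S) (P \ Q) hk

end SpookyReach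

/-- Only the moves on `A` are played; a pebble that the black game takes away becomes a ghost. -/
theorem BlackReach.exists_spookyReach (h : BlackReach G r Q Q') (hQ : Q.card ≤ r)
    (hA : ∀ u v, G.Adj u v → v ∈ A → u ∈ A) (H : Finset V) (hk : r + H.card ≤ k) (S : Finset V) :
    ∃ S' ⊆ S ∪ A, SpookyReach G k (Q ∩ A ∪ H, S) (Q' ∩ A ∪ H, S') := by
  suffices Q'.card ≤ r ∧ ∃ S' ⊆ S ∪ A, SpookyReach G k (Q ∩ A ∪ H, S) (Q' ∩ A ∪ H, S') from this.2
  have hcard (R : Finset V) (hR : R.card ≤ r) : (R ∩ A ∪ H).card ≤ k := by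
    have := Finset.card_union_le (R ∩ A) H
    have := Finset.card_le_card (Finset.inter_subset_left (s₁ := R) (s₂ := A))
    omega
  induction h with
  | refl => exact ⟨hQ, S, Finset.subset_union_left, .refl⟩
  | @tail Q₁ Q₂ _ hmove ih =>
    obtain ⟨hQ₁, S', hS', hreach⟩ := ih
    refine ⟨hmove.2, ?_⟩
    rcases hmove with ⟨⟨v, rfl, hv⟩ | hsub, hQ₂⟩
    · by_cases hvA : v ∈ A
      · have hinsert : insert v Q₁ ∩ A ∪ H = insert v (Q₁ ∩ A ∪ H) := by
          rw [Finset.insert_inter_of_mem hvA, Finset.insert_union]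
        refine ⟨S', hS', hreach.trans ?_⟩
        rw [hinsert]
        refine .pebble (fun u hu => ?_) (hinsert ▸ hcard _ hQ₂)
        exact Finset.mem_union_left _ (Finset.mem_inter.mpr ⟨hv u hu, hA u v hu hvA⟩)
      · rw [Finset.insert_inter_of_notMem hvA]
        exact ⟨S', hS', hreach⟩
    · refine ⟨_, Finset.union_subset hS' ?_, hreach.trans (.ghost (Finset.union_subset_union_left
        (Finset.inter_subset_inter_right hsub)) (hcard _ hQ₁))⟩
      intro x hx
      simp only [Finset.mem_sdiff, Finset.mem_union, Finset.mem_inter] at hx ⊢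
      tauto

/-- The black pebble game with `k` pebbles reaches a position in which a pebble can be placed on
`v`. -/
def CanPlace (G : Digraph V) (k : ℕ) (v : V) : Prop :=
  ∃ P, BlackReach G k ∅ P ∧ (∀ u, G.Adj u v → u ∈ P) ∧ (insert v P).card ≤ k

theorem BlackReach.canPlace (h : BlackReach G k ∅ P) (hv : v ∈ P) : CanPlace G k v := by
  induction h with
  | refl => exact absurd hv (Finset.notMem_empty v)
  | @tail Q₁ Q₂ h hmove ih =>
    obtain ⟨⟨w, rfl, hw⟩ | hsub, hcard⟩ := hmove
    · rcases Finset.mem_insert.mp hv with rfl | hv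
      · exact ⟨Q₁, h, hw, hcard⟩
      · exact ih hv
    · exact ih (hsub hv)

namespace CanPlace

theorem of_reaches {u : V} (h : CanPlace G k v) (huv : Relation.ReflTransGen G.Adj u v) :
    CanPlace G k u := by
  induction huv using Relation.ReflTransGen.head_induction_on with
  | refl => exact h
  | head huw _ ih =>
    obtain ⟨P, hP, hpred, -⟩ := ih
    exact hP.canPlace (hpred _ huw)

theorem exists_spookyReach (hv : CanPlace G r v) (hA : ∀ u v, G.Adj u v → v ∈ A → u ∈ A)
    (hvA : ∀ u, G.Adj u v → u ∈ A) (H : Finset V) (hk : r + H.card ≤ k) (S : Finset V) :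
    ∃ R ⊆ A, (∀ u, G.Adj u v → u ∈ R) ∧ (insert v R).card ≤ r ∧
      ∃ S' ⊆ S ∪ A, SpookyReach G k (H, S) (R ∪ H, S') := by
  obtain ⟨P, hP, hpred, hcard⟩ := hv
  obtain ⟨S', hS', hreach⟩ := hP.exists_spookyReach (by simp) hA H hk S
  rw [Finset.empty_inter, Finset.empty_union] at hreach
  exact ⟨P ∩ A, Finset.inter_subset_right, fun u hu => Finset.mem_inter.mpr ⟨hpred u hu, hvA u hu⟩,
    (Finset.card_le_card (Finset.insert_subset_insert _ Finset.inter_subset_left)).trans hcard,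
    S', hS', hreach⟩

theorem exists_erase_ghost (hv : CanPlace G k v) (hvo : v ≠ o) (hvA : v ∉ A)
    (hA : ∀ u v, G.Adj u v → v ∈ A → u ∈ A) (hpredA : ∀ u, G.Adj u v → u ∈ A)
    (hS : S ⊆ insert v A) : ∃ S' ⊆ A, SpookyReach G (k + 1) ({o}, S) ({o}, S') := by
  obtain ⟨R, hRA, hpred, hcard, S', hS', hreach⟩ :=
    hv.exists_spookyReach (k := k + 1) hA hpredA {o} (by simp) S
  have hvR : v ∉ R := fun h => hvA (hRA h)
  rw [Finset.card_insert_of_notMem hvR] at hcard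
  have hRo : (R ∪ {o}).card ≤ R.card + 1 := Finset.card_union_le _ _
  refine ⟨_, ?_, hreach.trans (.trans (.erase_ghost (v := v) (fun u hu => ?_) ?_ (by omega))
    (.ghost (Q := {o}) Finset.subset_union_right (by omega)))⟩
  · intro x hx
    have hxS' : x ∈ S' → x ∈ S ∨ x ∈ A := fun h => Finset.mem_union.mp (hS' h)
    have hxS : x ∈ S → x = v ∨ x ∈ A := fun h => Finset.mem_insert.mp (hS h)
    have hxR : x ∈ R → x ∈ A := fun h => hRA h
    simp only [Finset.mem_union, Finset.mem_sdiff, Finset.mem_singleton] at hx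
    tauto
  · exact Finset.mem_union_left _ (hpred u hu)
  · simp only [Finset.mem_union, Finset.mem_singleton, hvR, hvo, or_self, not_false_eq_true]

end CanPlace

/-- The ghosts are removed from the top to the bottom. -/
theorem SpookyReach.clear_ghosts (hG : G.IsAcyclic) (hplace : ∀ v ∈ A, CanPlace G k v)
    (hA : ∀ u v, G.Adj u v → v ∈ A → u ∈ A) (ho : o ∉ A) (hS : S ⊆ A) :
    SpookyReach G (k + 1) ({o}, S) ({o}, ∅) := by
  induction A using Finset.strongInduction generalizing S with
  | H A ih =>
    rcases A.eq_empty_or_nonempty with rfl | hne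
    · rw [Finset.subset_empty.mp hS]
      exact .refl
    · obtain ⟨v, hv, htop⟩ := exists_forall_not_adj_of_isAcyclic hG hne
      have herase (u w : V) (huw : G.Adj u w) (hw : w ∈ A) : u ∈ A.erase v :=
        Finset.mem_erase.mpr ⟨fun h => htop w hw (h ▸ huw), hA u w huw hw⟩
      have hA' (u w : V) (huw : G.Adj u w) (hw : w ∈ A.erase v) : u ∈ A.erase v :=
        herase u w huw (Finset.mem_of_mem_erase hw)
      obtain ⟨S', hS', hreach⟩ := (hplace v hv).exists_erase_ghost (o := o)
        (fun h => ho (h ▸ hv)) (Finset.notMem_erase v A) hA' (fun u hu => herase u v hu hv)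
        (hS.trans (Finset.insert_erase hv).ge)
      exact hreach.trans (ih _ (Finset.erase_ssubset hv)
        (fun w hw => hplace w (Finset.mem_of_mem_erase hw)) hA'
        (fun h => ho (Finset.mem_of_mem_erase h)) hS')

/-- Pebble the output by a black strategy, and then clear the ghosts that this leaves. -/
theorem spookyPebblable_of_canPlace [Finite V] (hG : G.IsAcyclic) (ho : ∀ v, G.IsRoot v ↔ v = o)
    (hplace : ∀ v, v ≠ o → CanPlace G k v) (hplace' : CanPlace G (k + 1) o) :
    SpookyPebblable G (k + 1) := by
  have := Fintype.ofFinite V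
  have hpredo (u v : V) (huv : G.Adj u v) : u ∈ Finset.univ.erase o :=
    Finset.mem_erase.mpr ⟨fun h => (ho u).mpr h v huv, Finset.mem_univ _⟩
  have hreach : SpookyReach G (k + 1) (∅, ∅) ({o}, ∅) := by
    obtain ⟨R, hR, hpred, hcard, S, hS, hreach⟩ := hplace'.exists_spookyReach
      (k := k + 1) (A := Finset.univ.erase o)
      (fun u v huv _ => hpredo u v huv) (hpredo · o) ∅ le_rfl ∅
    rw [Finset.union_empty] at hreach
    rw [Finset.empty_union] at hS
    refine hreach.trans (.trans (.pebble hpred hcard) (.trans (.ghost (Q := {o}) (by simp) hcard)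
      (.clear_ghosts hG (fun v hv => hplace v (Finset.ne_of_mem_erase hv))
        (fun u v huv _ => hpredo u v huv) (Finset.notMem_erase o _)
        (Finset.union_subset hS ?_))))
    rw [Finset.insert_sdiff_of_mem _ (Finset.mem_singleton_self o)]
    exact Finset.sdiff_subset.trans hR
  obtain ⟨T, P, S, hP₀, hS₀, hP, hS, hmove, hcard⟩ := hreach.exists_sequence (by simp)
  exact ⟨T, P, S, ⟨hP₀, hS₀, fun v => by rw [hP, ho, Finset.mem_singleton], hS, hmove⟩, hcard⟩

end Spooky

section Rectangle

variable {V : Type*} {G : Digraph V} {φ : ℕ → ℕ → V} {q : V} {k m c a b j : ℕ}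

/-- The vertices `φ a b` with `a ≤ m` and `b ≤ c` form a rectangular grid above `φ 0 0`: the other
vertices have no predecessors but the left and the lower neighbour. The predecessors of `φ 0 0` are
arbitrary. -/
def IsRectangle (G : Digraph V) (φ : ℕ → ℕ → V) (m c : ℕ) : Prop :=
  ∀ a b, a ≤ m → b ≤ c → ¬ (a = 0 ∧ b = 0) → ∀ u, G.Adj u (φ a b) →
    (∃ a', a = a' + 1 ∧ u = φ a' b) ∨ ∃ b', b = b' + 1 ∧ u = φ a b'

theorem isRectangle_diamondVertex (ha : a < k) (hb : b < k) :
    IsRectangle (attachDiamond G q k) (diamondVertex q k) a b :=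
  fun _ _ ha' hb' h _ hu =>
    (attachDiamond_adj_diamondVertex_iff (by omega) (by omega) h).mp hu

theorem isRectangle_diamondVertex_swap (ha : a < k) (hb : b < k) :
    IsRectangle (attachDiamond G q k) (fun x y => diamondVertex q k y x) b a :=
  fun _ _ hb' ha' h _ hu =>
    ((attachDiamond_adj_diamondVertex_iff (by omega) (by omega) (by tauto)).mp hu).symm

variable [DecidableEq V]

/-- The position between the rows `a` and `a + 1` of a rectangle in which the pebbles with second
coordinate below `j` have already moved up. -/
def staircase (φ : ℕ → ℕ → V) (c a j : ℕ) : Finset V :=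
  (Finset.range (c + 1)).image fun b => φ (if b < j then a + 1 else a) b

theorem card_staircase_le : (staircase φ c a j).card ≤ c + 1 :=
  Finset.card_image_le.trans_eq (Finset.card_range _)

theorem mem_staircase_of_lt (hb : b ≤ c) (hbj : b < j) :
    φ (a + 1) b ∈ staircase φ c a j :=
  Finset.mem_image.mpr ⟨b, Finset.mem_range.mpr (by omega), by rw [if_pos hbj]⟩

theorem mem_staircase_of_le (hb : b ≤ c) (hjb : j ≤ b) : φ a b ∈ staircase φ c a j :=
  Finset.mem_image.mpr ⟨b, Finset.mem_range.mpr (by omega), by rw [if_neg (by omega)]⟩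

theorem staircase_succ_subset :
    staircase φ c a (j + 1) ⊆ insert (φ (a + 1) j) (staircase φ c a j) := by
  intro x hx
  obtain ⟨b, hb, rfl⟩ := Finset.mem_image.mp hx
  have hb : b ≤ c := by simpa [Nat.lt_succ_iff] using hb
  rcases lt_trichotomy b j with h | rfl | h
  · rw [if_pos (by omega)]
    exact Finset.mem_insert_of_mem (mem_staircase_of_lt hb h)
  · rw [if_pos (by omega)]
    exact Finset.mem_insert_self _ _
  · rw [if_neg (by omega)]
    exact Finset.mem_insert_of_mem (mem_staircase_of_le hb h.le)

theorem staircase_last : staircase φ c a (c + 1) = staircase φ c (a + 1) 0 :=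
  Finset.image_congr fun b hb => by simp [Finset.mem_range.mp hb]

namespace IsRectangle

theorem blackReach_first_row (hφ : IsRectangle G φ m c) (hj : j ≤ c) :
    BlackReach G (c + 2) {φ 0 0} ((Finset.range (j + 1)).image (φ 0)) := by
  induction j with
  | zero => exact .refl
  | succ j ih =>
    refine (ih (by omega)).trans ?_
    rw [Finset.range_add_one (n := j + 1), Finset.image_insert]
    refine .place (fun u hu => ?_) ?_
    · rcases hφ 0 (j + 1) (Nat.zero_le m) hj (by omega) u hu with ⟨a', h, -⟩ | ⟨b', h, rfl⟩
      · omega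
      · exact Finset.mem_image_of_mem _ (Finset.mem_range.mpr (by omega))
    · have := Finset.card_image_le (s := Finset.range (j + 1)) (f := φ 0)
      rw [Finset.card_range] at this
      omega

theorem blackReach_staircase (hφ : IsRectangle G φ m c) (ha : a + 1 ≤ m) (hj : j ≤ c + 1) :
    BlackReach G (c + 2) (staircase φ c a 0) (staircase φ c a j) := by
  induction j with
  | zero => exact .refl
  | succ j ih =>
    refine (ih (by omega)).trans (.trans (.place (fun u hu => ?_)
      (Nat.succ_le_succ card_staircase_le)) (.drop staircase_succ_subset
        (card_staircase_le.trans (Nat.le_succ _))))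
    rcases hφ (a + 1) j ha (by omega) (by omega) u hu with ⟨a', h, rfl⟩ | ⟨b', rfl, rfl⟩
    · obtain rfl : a = a' := Nat.succ_injective h
      exact mem_staircase_of_le (by omega) le_rfl
    · exact mem_staircase_of_lt (by omega) (Nat.lt_succ_self _)

theorem blackReach_row (hφ : IsRectangle G φ m c) (ha : a ≤ m) :
    BlackReach G (c + 2) {φ 0 0} (staircase φ c a 0) := by
  induction a with
  | zero => simpa [staircase] using hφ.blackReach_first_row le_rfl
  | succ a ih =>
    have hsweep := hφ.blackReach_staircase ha le_rfl
    rw [staircase_last] at hsweep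
    exact (ih (by omega)).trans hsweep

theorem blackReach (hφ : IsRectangle G φ m c) : BlackReach G (c + 2) {φ 0 0} {φ m c} :=
  (hφ.blackReach_row le_rfl).trans
    (.drop (Finset.singleton_subset_iff.mpr (mem_staircase_of_le le_rfl (Nat.zero_le c)))
      (Finset.card_singleton _ ▸ Nat.le_add_left 1 _))

end IsRectangle

variable {P P' : Finset V}

theorem BlackReach.attachDiamond {d : ℕ} (h : BlackReach G k P P') :
    BlackReach (attachDiamond G q d) k (P.image Sum.inl) (P'.image Sum.inl) := by
  refine Relation.ReflTransGen.lift
    (fun P => P.image (Sum.inl : V → V ⊕ DiamondInner d)) ?_ _ _ h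
  rintro P P' ⟨⟨v, rfl, hv⟩ | hsub, hcard⟩
  · refine ⟨.inl ⟨.inl v, Finset.image_insert _ _ _, ?_⟩, Finset.card_image_le.trans hcard⟩
    rintro (u | u) hu
    · exact Finset.mem_image_of_mem _ (hv u hu)
    · exact hu.elim
  · exact ⟨.inr (Finset.image_subset_image hsub), Finset.card_image_le.trans hcard⟩

/-- Sweeping the rectangle below a vertex of the diamond along its shorter side takes at most `k`
pebbles, except for the output. -/
theorem spookyPebblable_attachDiamond [Finite V] (hk : 2 ≤ k) (hG : G.IsAcyclic)
    (hreach : ∀ v, Relation.ReflTransGen G.Adj v q) (h : BlackReach G k ∅ {q}) :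
    SpookyPebblable (attachDiamond G q k) (k + 1) := by
  have hq : BlackReach (attachDiamond G q k) k ∅ {diamondVertex q k 0 0} := by
    simpa only [diamondVertex_zero, Finset.image_empty, Finset.image_singleton]
      using h.attachDiamond (q := q) (d := k)
  refine spookyPebblable_of_canPlace (isAcyclic_attachDiamond hG)
    (isRoot_attachDiamond_iff hk hreach) ?_ ?_
  · rintro (v | v) hv
    · refine (hq.canPlace (Finset.mem_singleton_self _)).of_reaches ?_
      rw [diamondVertex_zero]
      exact (hreach v).lift Sum.inl fun _ _ h => h
    · obtain ⟨⟨⟨a, ha⟩, ⟨b, hb⟩⟩, hab⟩ := v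
      rw [← diamondVertex_of_pos (q := q) ha hb hab] at hv ⊢
      have hlt : b + 1 < k ∨ a + 1 < k := by
        by_contra! hge
        exact hv (by rw [show a = k - 1 by omega, show b = k - 1 by omega])
      refine BlackReach.canPlace (hq.trans ?_) (Finset.mem_singleton_self _)
      rcases hlt with hlt | hlt
      · exact (isRectangle_diamondVertex ha hb).blackReach.mono hlt
      · exact (isRectangle_diamondVertex_swap ha hb).blackReach.mono hlt
  · have htop : BlackReach (attachDiamond G q k) (k + 1) {diamondVertex q k 0 0}
        {diamondVertex q k (k - 1) (k - 1)} :=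
      (isRectangle_diamondVertex (by omega) (by omega)).blackReach.mono (by omega)
    exact ((hq.mono (Nat.le_succ k)).trans htop).canPlace (Finset.mem_singleton_self _)

end Rectangle

/-! ### From the spooky to the black pebble game -/

section Unspooky

variable {V : Type*} {G : Digraph V} {k : ℕ} {q v w : V}

/-- The upper half of the diamond as a triangular grid, with the output of the diamond as its
apex. -/
def diamondGrid (q : V) (k a b : ℕ) : V ⊕ DiamondInner k :=
  diamondVertex q k (k - 1 - a) (k - 1 - b)

theorem isGrid_diamondGrid : IsGrid (attachDiamond G q k) (diamondGrid q k) k where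
  inj a b a' b' h h' he := by
    have := diamondVertex_injective (by omega) (by omega) (by omega) (by omega) he
    omega
  adj_left a b h := (attachDiamond_adj_diamondVertex_iff (by omega) (by omega) (by omega)).mpr
    (.inl ⟨k - 1 - (a + 1), by omega, rfl⟩)
  adj_right a b h := (attachDiamond_adj_diamondVertex_iff (by omega) (by omega) (by omega)).mpr
    (.inr ⟨k - 1 - (b + 1), by omega, rfl⟩)

theorem isGridCap_diamondGrid (hk : 2 ≤ k) :
    IsGridCap (attachDiamond G q k) (diamondGrid q k) {diamondGrid q k 0 0} := by
  rintro _ rfl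
  exact .inr ⟨isGrid_diamondGrid.adj_right 0 0 hk, isGrid_diamondGrid.adj_left 0 0 hk⟩

theorem inl_ne_diamondGrid {a b : ℕ} (hk : 2 ≤ k) (hab : a + b < k) :
    .inl v ≠ diamondGrid q k a b := by
  intro h
  have := (inl_eq_diamondVertex_iff (by omega) (by omega)).mp h
  omega

theorem inl_notMem_gridCells [DecidableEq V] (hk : 2 ≤ k) :
    .inl v ∉ gridCells (diamondGrid q k) k := by
  intro h
  obtain ⟨a, b, -, hab, he⟩ := mem_gridCells.mp h
  exact inl_ne_diamondGrid hk hab he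

theorem card_toLeft_le_of_not_gridOpen (hk : 2 ≤ k) {R : Finset (V ⊕ DiamondInner k)}
    (hcard : R.card ≤ k + 1)
    (h : ¬ GridOpen (diamondGrid q k) k {diamondGrid q k 0 0} R) : R.toLeft.card ≤ k := by
  classical
  obtain ⟨x, hx, hgrid⟩ := exists_mem_of_not_gridOpen h
  rcases x with v | v
  · rcases hgrid with hcell | hapex
    · exact absurd hcell (inl_notMem_gridCells hk)
    · exact absurd hapex (inl_ne_diamondGrid hk (by omega))
  · have hright : 0 < R.toRight.card := Finset.card_pos.mpr ⟨v, Finset.mem_toRight.mpr hx⟩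
    have := R.card_toLeft_add_card_toRight
    omega

variable [DecidableEq V] {T : ℕ} {P S : ℕ → Finset V}

namespace IsSpookyStrategy

theorem blackMove_min (h : IsSpookyStrategy G T P S) (t : ℕ) :
    BlackMove G (P (min t T)) (P (min (t + 1) T)) := by
  rcases Nat.lt_or_ge t T with ht | ht
  · rw [Nat.min_eq_left ht.le, Nat.min_eq_left (Nat.succ_le_of_lt ht)]
    exact (h.move t ht).blackMove
  · rw [Nat.min_eq_right ht, Nat.min_eq_right (Nat.le_succ_of_le ht)]
    exact .inr subset_rfl

/-- The vertex loses its pebble or its ghost for the last time by an unpebbling. -/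
theorem exists_forall_adj_mem (h : IsSpookyStrategy G T P S) (hv : ¬ G.IsRoot v) {t : ℕ}
    (ht : t ≤ T) (hvP : v ∈ P t) : ∃ t' ≥ t, t' ≤ T ∧ ∀ u, G.Adj u v → u ∈ P t' := by
  obtain ⟨τ, htτ, hτT, hτ, hlast⟩ := exists_last_time (p := fun t => v ∈ P t ∨ v ∈ S t) ht
    (.inl hvP) (by rw [h.pebbles_end, h.ghosts_end]; simpa using hv)
  refine ⟨τ, htτ, hτT.le, ?_⟩
  have hsucc := hlast (τ + 1) (by omega) (by omega)
  obtain ⟨w, ⟨hP, hS, -⟩ | ⟨hP, hS, hw⟩ | ⟨hP, hS⟩ | ⟨hP, hS, -⟩⟩ := h.move τ hτT <;>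
    rw [hP, hS] at hsucc <;>
    simp only [Finset.mem_union, Finset.mem_sdiff, Finset.mem_singleton] at hsucc
  · tauto
  · obtain rfl : v = w := by tauto
    exact hw
  · tauto
  · tauto

theorem exists_mem_of_reaches (h : IsSpookyStrategy G T P S)
    (hvw : Relation.ReflTransGen G.Adj v w) (hw : ¬ G.IsRoot w) {t : ℕ} (ht : t ≤ T)
    (hwP : w ∈ P t) : ∃ t' ≥ t, t' ≤ T ∧ v ∈ P t' := by
  induction hvw generalizing t with
  | refl => exact ⟨t, le_rfl, ht, hwP⟩
  | @tail u w _ huw ih =>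
    obtain ⟨t₁, htt₁, ht₁, hpred⟩ := h.exists_forall_adj_mem hw ht hwP
    obtain ⟨t₂, ht₁t₂, ht₂, hv⟩ := ih (fun hu => hu w huw) ht₁ (hpred u huw)
    exact ⟨t₂, htt₁.trans ht₁t₂, ht₂, hv⟩

end IsSpookyStrategy

theorem diamondVertex_notMem_gridCells {a b : ℕ} (hab : a + b + 1 < k) :
    diamondVertex q k a b ∉ gridCells (diamondGrid q k) k := by
  intro h
  obtain ⟨a', b', -, hab', he⟩ := mem_gridCells.mp h
  have := diamondVertex_injective (by omega) (by omega) (by omega) (by omega) he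
  omega

theorem BlackMove.toLeft {P P' : Finset (V ⊕ DiamondInner k)}
    (h : BlackMove (attachDiamond G q k) P P') : BlackMove G P.toLeft P'.toLeft := by
  rcases h with ⟨v | v, rfl, hv⟩ | hsub
  · refine .inl ⟨v, Finset.toLeft_insert_inl, fun u hu => ?_⟩
    exact Finset.mem_toLeft.mpr (hv (.inl u) hu)
  · exact .inr (by rw [Finset.toLeft_insert_inr])
  · exact .inr (Finset.toLeft_subset_toLeft hsub)

/-- A predecessor of the source that is filled lies below the upper half of the diamond, and there
is only one pebble there. -/
theorem IsLastClosing.exists_diamondVertex_mem {F : Set (V ⊕ DiamondInner k)}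
    {P : ℕ → Finset (V ⊕ DiamondInner k)} {τ t₁ : ℕ} (hk : 3 ≤ k)
    (h : IsLastClosing (attachDiamond G q k) (diamondGrid q k) k F P τ t₁)
    (hcard : (P (τ + 1)).card ≤ k + 1) :
    (P (τ + 1)).toLeft = ∅ ∧ ∃ a b, a + b + 2 = k ∧ diamondVertex q k a b ∈ P (τ + 1) := by
  have hone {x y : V ⊕ DiamondInner k} (hx : x ∈ P (τ + 1)) (hy : y ∈ P (τ + 1))
      (hx' : x ∉ gridCells (diamondGrid q k) k) (hy' : y ∉ gridCells (diamondGrid q k) k) :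
      x = y := by
    have hsplit := Finset.card_inter_add_card_sdiff (P (τ + 1)) (gridCells (diamondGrid q k) k)
    have hgrid := h.card_le
    exact Finset.card_le_one.mp (by omega) x (Finset.mem_sdiff.mpr ⟨hx, hx'⟩) y
      (Finset.mem_sdiff.mpr ⟨hy, hy'⟩)
  obtain ⟨a, b, hab, -, hpred⟩ := h.exists_source
  have hadj (u : V ⊕ DiamondInner k) :=
    attachDiamond_adj_diamondVertex_iff (G := G) (q := q) (k := k) (a := k - 1 - a) (b := k - 1 - b)
      (by omega) (by omega) (by omega) (u := u)
  obtain ⟨x, y, hxy, hmem⟩ : ∃ x y, x + y + 2 = k ∧ diamondVertex q k x y ∈ P (τ + 1) := by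
    rcases Nat.eq_zero_or_pos b with rfl | hb
    · exact ⟨0, k - 2, by omega,
        h.subset (hpred _ ((hadj _).mpr (.inr ⟨k - 2, by omega, by congr 1; omega⟩)))⟩
    · exact ⟨b - 1, a, by omega,
        h.subset (hpred _ ((hadj _).mpr (.inl ⟨b - 1, by omega, by congr 1; omega⟩)))⟩
  refine ⟨Finset.eq_empty_of_forall_notMem fun v hv => ?_, x, y, hxy, hmem⟩
  have hvxy := hone (Finset.mem_toLeft.mp hv) hmem (inl_notMem_gridCells (by omega))
    (diamondVertex_notMem_gridCells (by omega))
  have := (inl_eq_diamondVertex_iff (by omega) (by omega)).mp hvxy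
  omega

/-- After the upper half of the diamond is closed for the last time, it always carries a pebble,
while `G` is empty at that time and `q` is pebbled later. -/
theorem SpookyPebblable.exists_blackMove (hk : 3 ≤ k)
    (hG : ∀ v, Relation.ReflTransGen G.Adj v q)
    (h : SpookyPebblable (attachDiamond G q k) (k + 1)) :
    ∃ P : ℕ → Finset V, (∀ t, BlackMove G (P t) (P (t + 1))) ∧ (∀ t, (P t).card ≤ k) ∧ P 0 = ∅ ∧
      ∃ t, q ∈ P t := by
  obtain ⟨T, P, S, hst, hcard⟩ := h
  have hapex : diamondGrid q k 0 0 ∈ P T :=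
    (hst.pebbles_end _).mpr ((isRoot_attachDiamond_iff (by omega) hG _).mpr rfl)
  obtain ⟨τ, -, hτT, hτ⟩ := isGrid_diamondGrid.exists_isLastClosing (G := attachDiamond G q k)
    (P := fun t => P (min t T)) (isGridCap_diamondGrid (by omega)) (by omega) hst.blackMove_min
    (Nat.zero_le T) (.of_forall_notMem (by simp [hst.pebbles_zero]) (by simp [hst.pebbles_zero]))
    (fun hopen => hopen.2 _ rfl (by simpa only [min_self] using hapex))
  obtain ⟨hempty, a, b, hab, hmem⟩ :=
    hτ.exists_diamondVertex_mem hk (hcard _ (Nat.min_le_right _ _))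
  rw [Nat.min_eq_left (Nat.succ_le_of_lt hτT)] at hmem
  have hreach : Relation.ReflTransGen (attachDiamond G q k).Adj (.inl q) (diamondVertex q k a b) :=
    diamondVertex_zero (q := q) (k := k) ▸
      diamondVertex_reaches (Nat.zero_le a) (Nat.zero_le b) (by omega) (by omega)
  obtain ⟨t, hτt, htT, hq⟩ := hst.exists_mem_of_reaches hreach
    (fun hroot => hroot _ (adj_diamondVertex_left (by omega) (by omega))) hτT hmem
  refine ⟨fun s => (P (min (τ + 1 + s) T)).toLeft, fun s => (hst.blackMove_min _).toLeft,
    fun s => ?_, hempty, t - (τ + 1), ?_⟩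
  · have hclosed := hτ.closed (min (τ + 1 + s) T) (by omega) (Nat.min_le_right _ _)
    rw [Nat.min_eq_left (Nat.min_le_right _ _)] at hclosed
    exact card_toLeft_le_of_not_gridOpen (by omega) (hcard _ (Nat.min_le_right _ _)) hclosed
  · rwa [Finset.mem_toLeft, Nat.add_sub_cancel' hτt, Nat.min_eq_left htT]

end Unspooky

/-! ### The reduction -/

namespace QCNF

variable (Φ : QCNF)

theorem isTrue_iff_spookyPebblable :
    Φ.IsTrue ↔ SpookyPebblable Φ.spookyGraph (3 * Φ.numVars + 5) := by
  constructor
  · intro h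
    exact spookyPebblable_attachDiamond (by omega) isAcyclic_gltGraph reaches_outFrom_zero
      (blackReach_of_isTrue h)
  · intro h
    obtain ⟨P, hmove, hcard, hzero, t, ht⟩ :=
      SpookyPebblable.exists_blackMove (by omega) reaches_outFrom_zero h
    exact isTrue_of_pebbled hmove hcard hzero ht

theorem isAcyclic_spookyGraph : Φ.spookyGraph.IsAcyclic :=
  isAcyclic_attachDiamond isAcyclic_gltGraph

theorem existsUnique_isRoot_spookyGraph : ∃! v, Φ.spookyGraph.IsRoot v :=
  ⟨_, (isRoot_attachDiamond_iff (by omega) reaches_outFrom_zero _).mpr rfl,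
    fun _ => (isRoot_attachDiamond_iff (by omega) reaches_outFrom_zero _).mp⟩

end QCNF

theorem mainTheorem3 :
    ∃ C : ℕ,
      (∀ Φ : QCNF,
        Finite Φ.SpookyVertex ∧
        Φ.spookyGraph.IsAcyclic ∧
        (∃! v, Φ.spookyGraph.IsRoot v) ∧
        Nat.card Φ.SpookyVertex ≤ C * Φ.size ^ 3 ∧
        (Φ.IsTrue ↔ SpookyPebblable Φ.spookyGraph (3 * Φ.numVars + 5))) ∧
      (∀ F : QBF,
        Finite F.toQCNF.SpookyVertex ∧
        F.toQCNF.spookyGraph.IsAcyclic ∧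
        (∃! v, F.toQCNF.spookyGraph.IsRoot v) ∧
        Nat.card F.toQCNF.SpookyVertex ≤ C * F.size ^ 3 ∧
        (F.IsTrue ↔ SpookyPebblable F.toQCNF.spookyGraph (3 * F.toQCNF.numVars + 5))) := by
  refine ⟨52 * 6 ^ 3, fun Φ => ?_, fun F => ?_⟩
  · refine ⟨inferInstance, Φ.isAcyclic_spookyGraph, Φ.existsUnique_isRoot_spookyGraph, ?_,
      Φ.isTrue_iff_spookyPebblable⟩
    exact Φ.card_spookyVertex_le.trans (Nat.mul_le_mul_right _ (by norm_num))
  · refine ⟨inferInstance, F.toQCNF.isAcyclic_spookyGraph,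
      F.toQCNF.existsUnique_isRoot_spookyGraph, ?_,
      F.isTrue_toQCNF.symm.trans F.toQCNF.isTrue_iff_spookyPebblable⟩
    calc Nat.card F.toQCNF.SpookyVertex ≤ 52 * F.toQCNF.size ^ 3 := F.toQCNF.card_spookyVertex_le
      _ ≤ 52 * (6 * F.size) ^ 3 := by gcongr; exact F.size_toQCNF_le
      _ = 52 * 6 ^ 3 * F.size ^ 3 := by ring
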